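/- Let $K$ be an oriented knot in $S^3$ that is represented by a positive diagram $D$ (a diagram all of whose crossings are positive) with $c$ crossings, and let $a_m(K)$ denote the coefficient of $z^m$ in the Conway polynomial $\nabla_K(z)$. Then for every integer $n \ge 1$ $$a_{2n}(K) \le \frac{1}{(2n-2)!}\, c^{2n-2}\, a_2(K).$$ -/

import Mathlib

open scoped LaurentPolynomial

/-- A Gauss diagram with signed arrows on a based oriented circle. The `2 * crossings` endpoints
of the arrows are numbered `0, 1, 2, …` in the order in which they are met when one walks along the
oriented circle from the base point. The arrow of the crossing `k` runs from its tail
`passage (k, true)` (where the knot passes over) to its head `passage (k, false)` (where it passes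
under), and `sign k` is the sign of the crossing. -/
structure GaussDiagram where
  crossings : ℕ
  passage : Fin crossings × Bool ≃ Fin (2 * crossings)
  sign : Fin crossings → ℤˣ

namespace GaussDiagram

variable (G : GaussDiagram)

/-- The half-edges of the 4-valent graph whose vertices are the crossings: `(k, o, b)` lies at the
crossing `k`, on the over-strand if `o = true` and on the under-strand if `o = false`; it leaves
the crossing if `b = true` and arrives at it if `b = false` (with respect to the orientation of the
knot). -/
abbrev HalfEdge : Type := Fin G.crossings × Bool × Bool

/-- The other half of the same edge: an edge joins each passage to the next one along the circle. -/
def otherEnd : G.HalfEdge → G.HalfEdge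
  | (k, o, true) =>
      let q := G.passage.symm (finRotate _ (G.passage (k, o)))
      (q.1, q.2, false)
  | (k, o, false) =>
      let q := G.passage.symm ((finRotate _).symm (G.passage (k, o)))
      (q.1, q.2, true)

/-- The next half-edge counterclockwise around the same crossing. At a positive crossing the
counterclockwise order is over-out, under-out, over-in, under-in; at a negative one it is over-out,
under-in, over-in, under-out. -/
def rotate : G.HalfEdge → G.HalfEdge
  | (k, o, b) => (k, !o, if (o = true ↔ G.sign k = 1) then b else !b)

/-- The faces of the cellularly embedded 4-valent graph (equivalently, the complementary regions on
the closed oriented surface that carries the diagram), as the orbits of the face-tracing map on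
half-edges. -/
def Face : Type := Quot fun h h' : G.HalfEdge => h' = G.rotate (G.otherEnd h)

/-- The diagram lies on the sphere: Euler's formula `V - E + F = 2` holds with `V = crossings` and
`E = 2 * crossings`. (Without crossings the diagram is a simple closed curve, with no vertices.) -/
def IsPlanar : Prop := G.crossings ≠ 0 → Nat.card G.Face = G.crossings + 2

/-- The arcs of the diagram, cut at the base point, are numbered `0, 1, …, crossings` along the
knot; a new arc begins at each under-passage. `arc j` is the number of the arc along which one
arrives at the endpoint `j`. -/
def arc (j : Fin (2 * G.crossings)) : Fin (G.crossings + 1) :=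
  ⟨(Finset.univ.filter fun k => G.passage (k, false) < j).card,
    Nat.lt_succ_of_le ((Finset.card_le_univ _).trans_eq (Fintype.card_fin _))⟩

/-- The Alexander matrix: the Fox derivatives, with all generators of the knot group sent to `t`, of
the Wirtinger relations (one row for each crossing) with respect to the arcs (one column for each
arc). If `x` is the over-arc and the under-strand goes from the arc `y` to the arc `y'`, the row
says `(1 - t) x + t y - y' = 0` at a positive crossing and `(1 - t) x + t y' - y = 0` at a negative
one. Here `t = s ^ 2`, where `s = LaurentPolynomial.T 1`. -/
noncomputable def alexanderMatrix :
    Matrix (Fin G.crossings) (Fin (G.crossings + 1)) ℤ[T;T⁻¹] :=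
  fun k =>
    let t : ℤ[T;T⁻¹] := LaurentPolynomial.T 2
    let x := G.arc (G.passage (k, true))
    let y := G.arc (G.passage (k, false))
    let y' := y + 1
    if G.sign k = 1 then Pi.single x (1 - t) + Pi.single y t - Pi.single y' 1
    else Pi.single x (1 - t) + Pi.single y' t - Pi.single y 1

/-- A representative of the Alexander polynomial (at `t = s ^ 2`), well defined up to units: the
maximal minor of the Alexander matrix obtained by deleting the column of the first arc. The first
and the last arc are the two parts of the arc that contains the base point. The relation that
identifies them is a consequence of the others for a planar diagram; it is the one row deleted
from the square matrix of the closed knot. -/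
noncomputable def alexanderDet : ℤ[T;T⁻¹] :=
  (G.alexanderMatrix.submatrix id Fin.succ).det

/-- `p` is the Conway polynomial: `p(s - s⁻¹)` is the Alexander polynomial at `t = s ^ 2`, up to a
unit `± s ^ k`, and `p` is normalized by `p(0) = 1`. -/
def IsConwayPolynomial (p : Polynomial ℤ) : Prop :=
  p.coeff 0 = 1 ∧
    Associated (Polynomial.aeval (LaurentPolynomial.T 1 - LaurentPolynomial.T (-1) : ℤ[T;T⁻¹]) p)
      G.alexanderDet

end GaussDiagram

/-- A diagram of an oriented knot in the 3-sphere, with a base point: it is given by its Gauss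
diagram, which has to be planar. -/
structure KnotDiagram extends GaussDiagram where
  planar : toGaussDiagram.IsPlanar

namespace KnotDiagram

variable (D : KnotDiagram)

/-- All crossings are positive. -/
def IsPositive : Prop := ∀ k, D.sign k = 1

/-- The Conway polynomial `∇_K(z)` of the knot `K` represented by the diagram `D`: the unique
polynomial with the property `IsConwayPolynomial`. -/
noncomputable def conwayPolynomial : Polynomial ℤ :=
  Classical.epsilon D.toGaussDiagram.IsConwayPolynomial

/-- The coefficient `a_m(K)` of `z ^ m` in the Conway polynomial of the knot represented by `D`. -/
noncomputable def conwayCoeff (m : ℕ) : ℤ := D.conwayPolynomial.coeff m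

end KnotDiagram

/-!
The coefficients of the Conway polynomial of a positive diagram count certain sets of crossings, and
the bound is a bound for the number of such sets.

Call a set `S` of crossings admissible if smoothing them leaves one component, and if the walk along
this component from the base point arrives at each crossing of `S` on the under-strand the first time.
Then `a_m` is the number of admissible sets with `m` elements (`KnotDiagram.conwayCoeff_eq_card`). A
nonempty admissible set contains an admissible pair (`GaussDiagram.Admissible.exists_pair`), so an
admissible set with `2n` elements is determined by an admissible pair and a set of `2n - 2` further
crossings. Hence `a_{2n} ≤ a_2 * choose c (2n - 2)`.

For the count, the Alexander determinant is replaced by the determinant of the Wirtinger relations on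
the edges of the diagram (`GaussDiagram.associated_alexanderDet`). This makes sense for diagrams
with switched and smoothed crossings too, and satisfies a skein relation
(`GaussDiagram.flowDet_skein`). Walking from the base point and applying the skein relation at each
crossing that is met for the first time on the under-strand, one ends with descending diagrams. Their
determinant is `1` if there is one component (`GaussDiagram.flowDet_resolve_of_isSingle`) and `0`
otherwise (`GaussDiagram.flowDet_resolve_of_not_isSingle`). So the determinant is the sum of
`(1 - t) ^ |S| * t ^ e(S)` over the admissible sets `S`, where `e(S)` counts the switched crossings.

Planarity enters through Euler's formula: by a dimension count every cycle on the diagram is a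
boundary (`GaussDiagram.exists_isIndex`), so the intersection number of two cycles vanishes
(`GaussDiagram.sum_intersection`). Cycles being boundaries yields the vanishing of the determinant in
the case of several components. The vanishing of intersection numbers yields that `e(S) + |S| / 2`
does not depend on `S` (`GaussDiagram.card_underFirst`), so that with `z = s - s⁻¹` and `t = s ^ 2`
the sum is a power of `t` times the sum of `z ^ |S|`.
-/

/-! ### Walks along a smoothed diagram -/

namespace GaussDiagram

variable (G : GaussDiagram)

/-- The endpoint from whose passage one departs after arriving at the endpoint `j`, if the crossings in
`S` are smoothed (respecting the orientation): the other endpoint of the same crossing if that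
crossing is smoothed, and `j` itself otherwise. -/
def turn (S : Finset (Fin G.crossings)) (j : Fin (2 * G.crossings)) : Fin (2 * G.crossings) :=
  let q := G.passage.symm j
  G.passage (q.1, if q.1 ∈ S then !q.2 else q.2)

variable {G}

theorem exists_passage (j : Fin (2 * G.crossings)) : ∃ k b, G.passage (k, b) = j :=
  ⟨_, _, G.passage.apply_symm_apply j⟩

theorem passage_inj {k l : Fin G.crossings} {a b : Bool} :
    G.passage (k, a) = G.passage (l, b) ↔ k = l ∧ a = b := by
  rw [G.passage.apply_eq_iff_eq, Prod.mk.injEq]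

theorem turn_passage (S : Finset (Fin G.crossings)) (k : Fin G.crossings) (b : Bool) :
    G.turn S (G.passage (k, b)) = G.passage (k, if k ∈ S then !b else b) := by
  simp [turn]

@[simp] theorem turn_turn (S : Finset (Fin G.crossings)) (j : Fin (2 * G.crossings)) :
    G.turn S (G.turn S j) = j := by
  obtain ⟨k, b, rfl⟩ := exists_passage j
  rw [turn_passage, turn_passage]
  by_cases h : k ∈ S <;> simp [h]

theorem turn_injective (S : Finset (Fin G.crossings)) : Function.Injective (G.turn S) :=
  (show Function.Involutive (G.turn S) from turn_turn S).injective

variable (G) in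
/-- The edge that follows a given edge when the crossings in `S` are smoothed. The knot is cut at the base
point; its edges are numbered by `Fin (2 * crossings + 1)`, so that `j.castSucc` is the edge that
arrives at the endpoint `j` and `j.succ` the one that departs from it. The last edge is absorbing. -/
def step (S : Finset (Fin G.crossings)) : Fin (2 * G.crossings + 1) → Fin (2 * G.crossings + 1) :=
  Fin.lastCases (Fin.last _) fun j => (G.turn S j).succ

@[simp] theorem step_last (S : Finset (Fin G.crossings)) :
    G.step S (Fin.last _) = Fin.last _ := by simp [step]

@[simp] theorem step_castSucc (S : Finset (Fin G.crossings)) (j : Fin (2 * G.crossings)) :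
    G.step S j.castSucc = (G.turn S j).succ := by simp [step]

variable (G) in
/-- The edge reached after `i` steps from the base point when the crossings in `S` are smoothed. -/
def walk (S : Finset (Fin G.crossings)) (i : ℕ) : Fin (2 * G.crossings + 1) := (G.step S)^[i] 0

@[simp] theorem walk_zero (S : Finset (Fin G.crossings)) : G.walk S 0 = 0 := rfl

theorem walk_succ (S : Finset (Fin G.crossings)) (i : ℕ) :
    G.walk S (i + 1) = G.step S (G.walk S i) := Function.iterate_succ_apply' _ _ _

theorem walk_eq_last_of_le {S : Finset (Fin G.crossings)} {i j : ℕ} (hij : i ≤ j)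
    (h : G.walk S i = Fin.last _) : G.walk S j = Fin.last _ := by
  induction j, hij using Nat.le_induction with
  | base => exact h
  | succ j _ ih => rw [walk_succ, ih, step_last]

theorem step_ne_zero {S : Finset (Fin G.crossings)} {e : Fin (2 * G.crossings + 1)}
    (h : e ≠ Fin.last _) : G.step S e ≠ 0 := by
  obtain ⟨j, rfl⟩ := Fin.exists_castSucc_eq.2 h
  simp

theorem step_injOn {S : Finset (Fin G.crossings)} {e f : Fin (2 * G.crossings + 1)}
    (he : e ≠ Fin.last _) (hf : f ≠ Fin.last _) (h : G.step S e = G.step S f) : e = f := by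
  obtain ⟨j, rfl⟩ := Fin.exists_castSucc_eq.2 he
  obtain ⟨l, rfl⟩ := Fin.exists_castSucc_eq.2 hf
  simp only [step_castSucc, Fin.succ_inj] at h
  rw [turn_injective S h]

theorem walk_injOn {S : Finset (Fin G.crossings)} {i j : ℕ} (hij : i < j)
    (hj : ∀ l < j, G.walk S l ≠ Fin.last _) : G.walk S i ≠ G.walk S j := by
  induction i generalizing j with
  | zero =>
    obtain ⟨j, rfl⟩ := Nat.exists_eq_succ_of_ne_zero hij.ne'
    rw [Nat.succ_eq_add_one, walk_succ]
    exact (step_ne_zero (hj j (by omega))).symm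
  | succ i ih =>
    obtain ⟨j, rfl⟩ := Nat.exists_eq_succ_of_ne_zero (Nat.ne_zero_of_lt hij)
    rw [Nat.succ_eq_add_one, walk_succ, walk_succ]
    intro h
    exact ih (by omega) (fun l hl => hj l (by omega))
      (step_injOn (hj i (by omega)) (hj j (by omega)) h)

/-- A walk cannot return to an edge before it reaches the last one, so it reaches the last edge within
`2 * crossings` steps. -/
theorem walk_eq_last (S : Finset (Fin G.crossings)) {i : ℕ} (hi : 2 * G.crossings ≤ i) :
    G.walk S i = Fin.last _ := by
  refine walk_eq_last_of_le hi ?_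
  by_contra hN
  have hne : ∀ l ≤ 2 * G.crossings, G.walk S l ≠ Fin.last _ := fun l hl h =>
    hN (walk_eq_last_of_le hl h)
  have hc : (Finset.univ.erase (Fin.last (2 * G.crossings))).card
      < (Finset.range (2 * G.crossings + 1)).card := by simp
  obtain ⟨a, ha, b, hb, hab, h⟩ := Finset.exists_ne_map_eq_of_card_lt_of_maps_to hc
    (f := G.walk S) (fun l hl => by
      simpa using hne l (by simpa [Nat.lt_succ_iff] using hl))
  simp only [Finset.mem_range, Nat.lt_succ_iff] at ha hb
  rcases lt_or_gt_of_ne hab with hlt | hlt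
  · exact walk_injOn hlt (fun l hl => hne l (by omega)) h
  · exact walk_injOn hlt (fun l hl => hne l (by omega)) h.symm

theorem exists_walk_castSucc {S : Finset (Fin G.crossings)} {i : ℕ} {j : Fin (2 * G.crossings)}
    (h : G.walk S i = j.succ) :
    ∃ a < i, G.walk S a = (G.turn S j).castSucc := by
  induction i with
  | zero => exact absurd h (Fin.succ_ne_zero j).symm
  | succ i ih =>
    by_cases hl : G.walk S i = Fin.last _
    · rw [walk_succ, hl, step_last] at h
      obtain ⟨a, ha, h'⟩ := ih (hl.trans h)
      exact ⟨a, by omega, h'⟩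
    · obtain ⟨l, hl⟩ := Fin.exists_castSucc_eq.2 hl
      rw [walk_succ, ← hl, step_castSucc, Fin.succ_inj] at h
      exact ⟨i, by omega, by rw [← hl, ← h, turn_turn]⟩

variable (G) in
/-- The diagram has a single component after the crossings in `S` are smoothed. -/
def IsSingle (S : Finset (Fin G.crossings)) : Prop := Function.Surjective (G.walk S)

variable (G) in
/-- When the crossings in `S` are smoothed, the walk from the base point meets `k` and arrives at it on
the under-strand the first time. -/
def UnderFirst (S : Finset (Fin G.crossings)) (k : Fin G.crossings) : Prop :=
  ∃ i, G.walk S i = (G.passage (k, false)).castSucc ∧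
    ∀ j ≤ i, G.walk S j ≠ (G.passage (k, true)).castSucc

variable (G) in
/-- Smoothing the crossings in `S` leaves a single component, and the walk from the base point arrives at
each of them on the under-strand the first time. The number of admissible sets with `m` elements is
the coefficient of `z ^ m` in the Conway polynomial of a positive diagram. -/
structure Admissible (S : Finset (Fin G.crossings)) : Prop where
  isSingle : G.IsSingle S
  underFirst : ∀ k ∈ S, G.UnderFirst S k

open Classical in
variable (G) in
/-- The crossings at which the walk arrives in its first `i` steps. -/
noncomputable def met (S : Finset (Fin G.crossings)) (i : ℕ) : Finset (Fin G.crossings) :=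
  Finset.univ.filter fun k => ∃ j < i, ∃ b, G.walk S j = (G.passage (k, b)).castSucc

theorem mem_met {S : Finset (Fin G.crossings)} {i : ℕ} {k : Fin G.crossings} :
    k ∈ G.met S i ↔ ∃ j < i, ∃ b, G.walk S j = (G.passage (k, b)).castSucc := by
  simp [met]

theorem met_mono (S : Finset (Fin G.crossings)) {i j : ℕ} (h : i ≤ j) : G.met S i ⊆ G.met S j := by
  intro k hk
  obtain ⟨l, hl, hb⟩ := mem_met.1 hk
  exact mem_met.2 ⟨l, by omega, hb⟩

theorem step_congr {S S' : Finset (Fin G.crossings)} {k : Fin G.crossings} {b : Bool}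
    (h : k ∈ S ↔ k ∈ S') :
    G.step S (G.passage (k, b)).castSucc = G.step S' (G.passage (k, b)).castSucc := by
  simp only [step_castSucc, turn_passage, h]

/-- The walk up to time `i` depends only on which of the crossings met before are smoothed. -/
theorem walk_congr {S S' : Finset (Fin G.crossings)} {i : ℕ}
    (h : ∀ k ∈ G.met S i, (k ∈ S' ↔ k ∈ S)) {j : ℕ} (hj : j ≤ i) :
    G.walk S' j = G.walk S j := by
  induction j with
  | zero => rfl
  | succ j ih =>
    rw [walk_succ, walk_succ, ih (by omega)]
    by_cases hl : G.walk S j = Fin.last _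
    · simp [hl]
    · obtain ⟨l, hl⟩ := Fin.exists_castSucc_eq.2 hl
      obtain ⟨k, b, rfl⟩ := exists_passage l
      rw [← hl]
      exact step_congr (h k (mem_met.2 ⟨j, by omega, b, hl.symm⟩))

theorem met_congr {S S' : Finset (Fin G.crossings)} {i j : ℕ}
    (h : ∀ k ∈ G.met S i, (k ∈ S' ↔ k ∈ S)) (hj : j ≤ i + 1) : G.met S' j = G.met S j := by
  ext k
  simp only [mem_met]
  constructor
  · rintro ⟨l, hl, hb⟩
    exact ⟨l, hl, by rwa [walk_congr h (by omega)] at hb⟩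
  · rintro ⟨l, hl, hb⟩
    exact ⟨l, hl, by rwa [walk_congr h (by omega)]⟩

theorem underFirst_iff_of_mem_met {S : Finset (Fin G.crossings)} {i : ℕ} {k : Fin G.crossings}
    (hk : k ∈ G.met S i) :
    G.UnderFirst S k ↔ ∃ a < i, G.walk S a = (G.passage (k, false)).castSucc ∧
      ∀ j ≤ a, G.walk S j ≠ (G.passage (k, true)).castSucc := by
  constructor
  · rintro ⟨a, ha, h⟩
    obtain ⟨j, hj, b, hb⟩ := mem_met.1 hk
    by_cases hai : a < i
    · exact ⟨a, hai, ha, h⟩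
    · cases b with
      | true => exact absurd hb (h j (by omega))
      | false => exact ⟨j, hj, hb, fun l hl => h l (by omega)⟩
  · rintro ⟨a, _, h⟩
    exact ⟨a, h⟩

theorem underFirst_congr {S S' : Finset (Fin G.crossings)} {i : ℕ}
    (h : ∀ k ∈ G.met S i, (k ∈ S' ↔ k ∈ S)) {k : Fin G.crossings} (hk : k ∈ G.met S (i + 1)) :
    G.UnderFirst S' k ↔ G.UnderFirst S k := by
  rw [underFirst_iff_of_mem_met hk,
    underFirst_iff_of_mem_met (i := i + 1) (by rwa [met_congr h le_rfl])]
  refine exists_congr fun a => and_congr_right fun ha => ?_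
  rw [walk_congr h (by omega)]
  refine and_congr_right fun _ => forall_congr' fun j => ?_
  refine forall_congr' fun hj => ?_
  rw [walk_congr h (by omega)]

/-- All crossings that the walk ever meets are met within the first `2 * crossings` steps. -/
theorem mem_met_of_walk {S : Finset (Fin G.crossings)} {i j : ℕ} (hi : 2 * G.crossings ≤ i)
    {k : Fin G.crossings} {b : Bool} (h : G.walk S j = (G.passage (k, b)).castSucc) :
    k ∈ G.met S i := by
  refine mem_met.2 ⟨j, ?_, b, h⟩
  by_contra hj
  rw [walk_eq_last S (by omega)] at h
  exact (Fin.castSucc_lt_last _).ne h.symm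

/-! ### Times of passage along a walk that covers the diagram -/

theorem IsSingle.exists_walk_le {S : Finset (Fin G.crossings)} (hS : G.IsSingle S)
    (e : Fin (2 * G.crossings + 1)) : ∃ i : Fin (2 * G.crossings + 1), G.walk S i = e := by
  obtain ⟨i, hi⟩ := hS e
  by_cases h : i < 2 * G.crossings + 1
  · exact ⟨⟨i, h⟩, hi⟩
  · refine ⟨Fin.last _, ?_⟩
    rw [← hi, walk_eq_last S (i := i) (by omega), walk_eq_last S (by simp)]

/-- The time at which the walk traverses an edge. -/
noncomputable def IsSingle.time {S : Finset (Fin G.crossings)} (hS : G.IsSingle S) :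
    Fin (2 * G.crossings + 1) ≃ Fin (2 * G.crossings + 1) :=
  (Equiv.ofBijective (fun i : Fin (2 * G.crossings + 1) => G.walk S i)
    (Finite.injective_iff_bijective.1
      (Finite.injective_iff_surjective.2 hS.exists_walk_le))).symm

section
variable {S : Finset (Fin G.crossings)} (hS : G.IsSingle S)

@[simp] theorem IsSingle.walk_time (e : Fin (2 * G.crossings + 1)) : G.walk S (hS.time e) = e :=
  (Equiv.ofBijective (fun i : Fin (2 * G.crossings + 1) => G.walk S i) _).apply_symm_apply e

theorem IsSingle.time_walk {i : ℕ} (hi : i ≤ 2 * G.crossings) :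
    (hS.time (G.walk S i) : ℕ) = i :=
  congrArg Fin.val ((Equiv.ofBijective (fun i : Fin (2 * G.crossings + 1) => G.walk S i)
    _).symm_apply_apply ⟨i, Nat.lt_succ_of_le hi⟩)

theorem IsSingle.time_lt_of_walk_eq {i : ℕ} {j : Fin (2 * G.crossings)}
    (h : G.walk S i = j.castSucc) : i < 2 * G.crossings := by
  by_contra hj
  rw [walk_eq_last S (by omega)] at h
  exact (Fin.castSucc_lt_last _).ne h.symm

@[simp] theorem IsSingle.time_zero : (hS.time 0 : ℕ) = 0 := by
  simpa using hS.time_walk (Nat.zero_le _)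

@[simp] theorem IsSingle.time_last : (hS.time (Fin.last _) : ℕ) = 2 * G.crossings := by
  have := hS.time_walk le_rfl
  rwa [walk_eq_last S le_rfl] at this

theorem IsSingle.time_succ (j : Fin (2 * G.crossings)) :
    (hS.time (G.turn S j).succ : ℕ) = hS.time j.castSucc + 1 := by
  have h := IsSingle.time_lt_of_walk_eq (hS.walk_time j.castSucc)
  rw [← step_castSucc, ← hS.walk_time j.castSucc, ← walk_succ, hS.walk_time]
  exact hS.time_walk h

theorem IsSingle.time_eq_iff {e f : Fin (2 * G.crossings + 1)} :
    (hS.time e : ℕ) = hS.time f ↔ e = f := by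
  rw [Fin.val_inj, EmbeddingLike.apply_eq_iff_eq]

theorem IsSingle.underFirst_iff {k : Fin G.crossings} :
    G.UnderFirst S k ↔ (hS.time (G.passage (k, false)).castSucc : ℕ)
      < hS.time (G.passage (k, true)).castSucc := by
  constructor
  · rintro ⟨i, hi, h⟩
    have h1 := IsSingle.time_lt_of_walk_eq hi
    rw [← hi, hS.time_walk h1.le]
    by_contra hlt
    exact h _ (not_lt.1 hlt) (hS.walk_time _)
  · intro h
    refine ⟨_, hS.walk_time _, fun j hj hw => ?_⟩
    rw [← hw, hS.time_walk (by omega)] at h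
    omega
end

/-- A function on the edges that increases by one along each step is the time of passage. -/
theorem walk_of_time {S : Finset (Fin G.crossings)} {τ : Fin (2 * G.crossings + 1) → ℕ}
    (h0 : τ 0 = 0) (hs : ∀ j, τ (G.turn S j).succ = τ j.castSucc + 1)
    (e : Fin (2 * G.crossings + 1)) : G.walk S (τ e) = e := by
  induction h : τ e generalizing e with
  | zero =>
    induction e using Fin.cases with
    | zero => rfl
    | succ j => have := hs (G.turn S j); rw [turn_turn, h] at this; omega
  | succ n ih =>
    induction e using Fin.cases with
    | zero => omega
    | succ j =>
      have h1 := hs (G.turn S j)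
      rw [turn_turn, h] at h1
      rw [walk_succ, ih (G.turn S j).castSucc (by omega), step_castSucc, turn_turn]

theorem isSingle_empty : G.IsSingle ∅ := by
  refine fun e => ⟨e, ?_⟩
  refine walk_of_time (τ := fun e => (e : ℕ)) rfl (fun j => ?_) e
  obtain ⟨k, b, rfl⟩ := exists_passage j
  simp [turn_passage]

theorem admissible_empty : G.Admissible ∅ := ⟨isSingle_empty, by simp⟩

/-! ### Circulations, faces and the Alexander numbering -/

variable (G) in
/-- An integral cycle on the underlying graph of the closed knot: at each crossing the inflow is the
outflow, and the two halves of the edge through the base point carry the same multiplicity. -/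
structure IsCirculation (χ : Fin (2 * G.crossings + 1) → ℤ) : Prop where
  closed : χ 0 = χ (Fin.last _)
  conserve : ∀ k, χ (G.passage (k, true)).castSucc + χ (G.passage (k, false)).castSucc
    = χ (G.passage (k, true)).succ + χ (G.passage (k, false)).succ

theorem apply_eq_apply_of_finRotate {α : Type*} {n : ℕ} {f : Fin n → α}
    (h : ∀ j, f (finRotate n j) = f j) (i j : Fin n) : f i = f j := by
  cases n with
  | zero => exact i.elim0
  | succ n =>
    have h0 : ∀ i, f i = f 0 := fun i => by
      induction i using Fin.induction with
      | zero => rfl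
      | succ i ih => rw [← ih, ← h i.castSucc, finRotate_apply, Fin.coeSucc_eq_succ]
    rw [h0 i, h0 j]

theorem apply_succ_eq_finRotate {α : Type*} {n : ℕ} {f : Fin (n + 1) → α}
    (h : f 0 = f (Fin.last n)) (j : Fin n) : f j.succ = f (finRotate n j).castSucc := by
  cases n with
  | zero => exact j.elim0
  | succ n =>
    induction j using Fin.lastCases with
    | last => rw [finRotate_last, Fin.castSucc_zero, Fin.succ_last, h]
    | cast j => rw [finRotate_apply, Fin.coeSucc_eq_succ, Fin.succ_castSucc]

theorem exists_unroll {α : Type*} {n : ℕ} (hn : 0 < n) (f : Fin n → α) :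
    ∃ g : Fin (n + 1) → α, g 0 = g (Fin.last n) ∧ ∀ j, g j.castSucc = f j := by
  cases n with
  | zero => omega
  | succ n =>
    refine ⟨Fin.lastCases (f 0) f, ?_, fun j => by simp⟩
    simp only
    rw [Fin.lastCases_last]
    exact Fin.lastCases_castSucc (motive := fun _ => α) (0 : Fin (n + 1))

variable (G) in
/-- The rational circulations on the edges of the closed knot; the value at `j` is the multiplicity
of the edge that arrives at the endpoint `j`. -/
def circulations : Submodule ℚ (Fin (2 * G.crossings) → ℚ) where
  carrier := {χ | ∀ k, χ (G.passage (k, true)) + χ (G.passage (k, false))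
    = χ (finRotate _ (G.passage (k, true))) + χ (finRotate _ (G.passage (k, false)))}
  add_mem' {a b} ha hb k := by
    have h1 := ha k
    have h2 := hb k
    simp only [Pi.add_apply]
    linarith
  zero_mem' k := by simp
  smul_mem' c a ha k := by
    simp only [Pi.smul_apply, smul_eq_mul, ← mul_add, ha k]

/-- A circulation is determined by its value at one edge and its jump along the over-strand at each
crossing. -/
theorem finrank_circulations_le (hc : 0 < G.crossings) :
    Module.finrank ℚ G.circulations ≤ G.crossings + 1 := by
  let z : Fin (2 * G.crossings) := ⟨0, by omega⟩
  let φ : (Fin (2 * G.crossings) → ℚ) →ₗ[ℚ] (Option (Fin G.crossings) → ℚ) :=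
    let ev : Fin (2 * G.crossings) → (Fin (2 * G.crossings) → ℚ) →ₗ[ℚ] ℚ := LinearMap.proj
    LinearMap.pi fun x => x.elim (ev z)
      fun k => ev (finRotate _ (G.passage (k, true))) - ev (G.passage (k, true))
  have hφ : Function.Injective (φ.domRestrict G.circulations) := by
    rw [← LinearMap.ker_eq_bot, LinearMap.ker_eq_bot']
    rintro ⟨χ, hχ⟩ h
    have h0 : χ z = 0 := congrFun h none
    have hk : ∀ k, χ (finRotate _ (G.passage (k, true))) - χ (G.passage (k, true)) = 0 :=
      fun k => congrFun h (some k)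
    ext e
    simp only [ZeroMemClass.coe_zero, Pi.zero_apply]
    rw [apply_eq_apply_of_finRotate (f := χ) (fun j => ?_) e z, h0]
    obtain ⟨k, b, rfl⟩ := exists_passage j
    have h1 := hk k
    have h2 := hχ k
    cases b <;> linarith
  have := LinearMap.finrank_le_finrank_of_injective hφ
  simpa using this

variable (G) in
/-- The half-edge that leaves the crossing of the endpoint `j` along the strand of `j`. -/
def outHalf (j : Fin (2 * G.crossings)) : G.HalfEdge :=
  ((G.passage.symm j).1, (G.passage.symm j).2, true)

variable (G) in
/-- The half-edge that arrives at the crossing of the endpoint `j` along the strand of `j`. -/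
def inHalf (j : Fin (2 * G.crossings)) : G.HalfEdge :=
  ((G.passage.symm j).1, (G.passage.symm j).2, false)

theorem inHalf_passage (k : Fin G.crossings) (b : Bool) :
    G.inHalf (G.passage (k, b)) = (k, b, false) := by simp [inHalf]

theorem outHalf_passage (k : Fin G.crossings) (b : Bool) :
    G.outHalf (G.passage (k, b)) = (k, b, true) := by simp [outHalf]

theorem otherEnd_outHalf (j : Fin (2 * G.crossings)) :
    G.otherEnd (G.outHalf j) = G.inHalf (finRotate _ j) := by
  simp [outHalf, otherEnd, inHalf]

theorem otherEnd_inHalf (j : Fin (2 * G.crossings)) :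
    G.otherEnd (G.inHalf j) = G.outHalf ((finRotate _).symm j) := by
  simp [outHalf, otherEnd, inHalf]

variable (G) in
/-- The face of a half-edge `h`: it lies to the right when one leaves the crossing along `h`. For an
outgoing half-edge this is the right side of the edge, for an incoming one the left side. -/
def face (h : G.HalfEdge) : G.Face := Quot.mk _ h

theorem face_rotate (h : G.HalfEdge) : G.face (G.rotate (G.otherEnd h)) = G.face h :=
  Eq.symm (Quot.sound (r := fun h h' : G.HalfEdge => h' = G.rotate (G.otherEnd h)) rfl)

theorem rotate_of_pos (hG : ∀ k, G.sign k = 1) (k : Fin G.crossings) (o b : Bool) :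
    G.rotate (k, o, b) = (k, !o, if o then b else !b) := by
  cases o <;> simp [rotate, hG]

instance : Finite G.Face := Quot.finite _

section
variable (hG : ∀ k, G.sign k = 1)
include hG

/-- The face to the right of the edge that arrives on the over-strand. -/
theorem face_right_over (k : Fin G.crossings) :
    G.face (G.outHalf ((finRotate _).symm (G.passage (k, true)))) = G.face (k, false, false) := by
  rw [← face_rotate, otherEnd_outHalf, Equiv.apply_symm_apply, inHalf_passage, rotate_of_pos hG]
  rfl

theorem face_right_under (k : Fin G.crossings) :
    G.face (G.outHalf ((finRotate _).symm (G.passage (k, false)))) = G.face (k, true, true) := by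
  rw [← face_rotate, otherEnd_outHalf, Equiv.apply_symm_apply, inHalf_passage, rotate_of_pos hG]
  rfl

theorem face_left_over (k : Fin G.crossings) :
    G.face (G.inHalf (finRotate _ (G.passage (k, true)))) = G.face (k, false, true) := by
  rw [← face_rotate, otherEnd_inHalf, Equiv.symm_apply_apply, outHalf_passage, rotate_of_pos hG]
  rfl

theorem face_left_under (k : Fin G.crossings) :
    G.face (G.inHalf (finRotate _ (G.passage (k, false)))) = G.face (k, true, false) := by
  rw [← face_rotate, otherEnd_inHalf, Equiv.symm_apply_apply, outHalf_passage, rotate_of_pos hG]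
  rfl
end

variable (G) in
/-- The boundary of a rational 2-chain: the multiplicity of an edge is the value to its left minus the
value to its right. -/
noncomputable def faceBoundary : (G.Face → ℚ) →ₗ[ℚ] (Fin (2 * G.crossings) → ℚ) :=
  let ev : G.Face → (G.Face → ℚ) →ₗ[ℚ] ℚ := LinearMap.proj
  LinearMap.pi fun j => ev (G.face (G.inHalf j)) - ev (G.face (G.outHalf ((finRotate _).symm j)))

theorem faceBoundary_apply (f : G.Face → ℚ) (j : Fin (2 * G.crossings)) :
    G.faceBoundary f j
      = f (G.face (G.inHalf j)) - f (G.face (G.outHalf ((finRotate _).symm j))) := rfl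

theorem range_faceBoundary_le (hG : ∀ k, G.sign k = 1) :
    LinearMap.range G.faceBoundary ≤ G.circulations := by
  rintro _ ⟨f, rfl⟩ k
  simp only [faceBoundary_apply, Equiv.symm_apply_apply, face_right_over hG, face_right_under hG,
    face_left_over hG, face_left_under hG, inHalf_passage, outHalf_passage]
  ring

/-- A 2-chain without boundary is constant, since the knot passes every crossing. -/
theorem finrank_ker_faceBoundary_le (hG : ∀ k, G.sign k = 1) (hc : 0 < G.crossings) :
    Module.finrank ℚ (LinearMap.ker G.faceBoundary) ≤ 1 := by
  have hone : (fun _ => 1 : G.Face → ℚ) ∈ LinearMap.ker G.faceBoundary := by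
    rw [LinearMap.mem_ker]
    ext j
    simp [faceBoundary_apply]
  refine finrank_le_one (⟨_, hone⟩ : LinearMap.ker G.faceBoundary) ?_
  · rintro ⟨f, hf⟩
    have hf' : ∀ j, f (G.face (G.inHalf j)) = f (G.face (G.outHalf ((finRotate _).symm j))) :=
      fun j => sub_eq_zero.1 (congrFun hf j)
    have h1 : ∀ k b b', f (G.face (k, b, b')) = f (G.face (k, true, true)) := by
      intro k
      have e1 := hf' (G.passage (k, true))
      have e2 := hf' (G.passage (k, false))
      have e3 := hf' (finRotate _ (G.passage (k, true)))
      rw [face_right_over hG, inHalf_passage] at e1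
      rw [face_right_under hG, inHalf_passage] at e2
      rw [face_left_over hG, Equiv.symm_apply_apply, outHalf_passage] at e3
      intro b b'
      cases b <;> cases b'
      · exact e2
      · exact e3
      · exact e1.trans e2
      · rfl
    have h2 : ∀ j, f (G.face (G.inHalf (finRotate _ j))) = f (G.face (G.inHalf j)) := by
      intro j
      rw [hf', Equiv.symm_apply_apply]
      exact (h1 _ _ _).trans (h1 _ _ _).symm
    refine ⟨f (G.face (G.inHalf ⟨0, by omega⟩)), ?_⟩
    refine Subtype.ext (funext fun x => ?_)
    obtain ⟨⟨k, b, b'⟩, rfl⟩ := Quot.exists_rep x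
    change _ = f (G.face (k, b, b'))
    have h3 := apply_eq_apply_of_finRotate (f := fun j => f (G.face (G.inHalf j))) h2
      ⟨0, by omega⟩ (G.passage (k, true))
    simp only [inHalf_passage] at h3
    refine (mul_one _).trans (h3.trans ((h1 _ _ _).trans (h1 _ _ _).symm))

/-- On the sphere every circulation bounds: with `crossings + 2` faces the boundaries have dimension at
least `crossings + 1`, and the circulations have at most this dimension. -/
theorem range_faceBoundary (hG : ∀ k, G.sign k = 1) (hP : G.IsPlanar) (hc : 0 < G.crossings) :
    LinearMap.range G.faceBoundary = G.circulations := by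
  refine Submodule.eq_of_le_of_finrank_le (range_faceBoundary_le hG) ?_
  have := Fintype.ofFinite G.Face
  have h1 := LinearMap.finrank_range_add_finrank_ker G.faceBoundary
  have h2 := hP hc.ne'
  rw [Module.finrank_fintype_fun_eq_card, ← Nat.card_eq_fintype_card, h2] at h1
  have h3 := finrank_circulations_le hc
  have h4 := finrank_ker_faceBoundary_le hG hc
  omega

variable (G) in
/-- `r` is an Alexander numbering of the faces for the circulation `χ`, recorded through its value `r e` on
the right of each edge `e`; the value on the left is `r e + χ e`. The equations identify the values of
the four corners at each positive crossing. -/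
structure IsIndex (χ r : Fin (2 * G.crossings + 1) → ℤ) : Prop where
  closed : r 0 = r (Fin.last _)
  over_out : ∀ k, r (G.passage (k, true)).succ = r (G.passage (k, false)).castSucc
  over_in : ∀ k, r (G.passage (k, true)).castSucc
    = r (G.passage (k, false)).castSucc + χ (G.passage (k, false)).castSucc
  under_out : ∀ k, r (G.passage (k, false)).succ
    = r (G.passage (k, false)).castSucc + χ (G.passage (k, true)).succ

/-- Every circulation in a planar diagram has an integral Alexander numbering. -/
theorem exists_isIndex (hG : ∀ k, G.sign k = 1) (hP : G.IsPlanar)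
    {χ : Fin (2 * G.crossings + 1) → ℤ} (hχ : G.IsCirculation χ) : ∃ r, G.IsIndex χ r := by
  rcases Nat.eq_zero_or_pos G.crossings with hc | hc
  · have : IsEmpty (Fin G.crossings) := by rw [hc]; infer_instance
    exact ⟨0, rfl, isEmptyElim, isEmptyElim, isEmptyElim⟩
  have hmem : (fun j => (χ j.castSucc : ℚ)) ∈ LinearMap.range G.faceBoundary := by
    rw [range_faceBoundary hG hP hc]
    intro k
    simp only [← apply_succ_eq_finRotate hχ.closed]
    exact_mod_cast hχ.conserve k
  obtain ⟨f, hf⟩ := hmem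
  have hf' := fun j => congrFun hf j
  simp only [faceBoundary_apply] at hf'
  obtain ⟨q, hq, hq'⟩ := exists_unroll (n := 2 * G.crossings) (by omega)
    fun j => f (G.face (G.outHalf ((finRotate _).symm j)))
  have hq'' : ∀ j : Fin (2 * G.crossings), q j.succ = f (G.face (G.outHalf j)) := fun j => by
    rw [apply_succ_eq_finRotate hq, hq', Equiv.symm_apply_apply]
  have e1 : ∀ k, q (G.passage (k, true)).succ = q (G.passage (k, false)).castSucc := fun k => by
    rw [hq', hq'', face_right_under hG, outHalf_passage]
  have e2 : ∀ k, q (G.passage (k, true)).castSucc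
      = q (G.passage (k, false)).castSucc + χ (G.passage (k, false)).castSucc := fun k => by
    have := hf' (G.passage (k, false))
    rw [face_right_under hG, inHalf_passage] at this
    rw [hq', hq', face_right_under hG, face_right_over hG, ← this]
    ring
  have e3 : ∀ k, q (G.passage (k, false)).succ
      = q (G.passage (k, false)).castSucc + χ (G.passage (k, true)).succ := fun k => by
    have := hf' (finRotate _ (G.passage (k, true)))
    rw [face_left_over hG, ← apply_succ_eq_finRotate hχ.closed, Equiv.symm_apply_apply,
      outHalf_passage] at this
    rw [hq', hq'', face_right_under hG, ← this, outHalf_passage]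
    ring
  -- The values of the rational solution differ by integers.
  have hint : ∀ e, ∃ m : ℤ, q e - q 0 = m := by
    intro e
    induction e using Fin.induction with
    | zero => exact ⟨0, by simp⟩
    | succ j ih =>
      obtain ⟨m, hm⟩ := ih
      obtain ⟨k, b, rfl⟩ := exists_passage j
      cases b with
      | true =>
        refine ⟨m - χ (G.passage (k, false)).castSucc, ?_⟩
        push_cast
        linarith [e1 k, e2 k]
      | false =>
        refine ⟨m + χ (G.passage (k, true)).succ, ?_⟩
        push_cast
        linarith [e3 k]
  choose r hr using hint
  have inj : ∀ {a b : ℤ}, (a : ℚ) = b → a = b := fun h => by exact_mod_cast h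
  refine ⟨r, inj ?_, fun k => inj ?_, fun k => inj ?_, fun k => inj ?_⟩
  · rw [← hr, ← hr, hq]
  · rw [← hr, ← hr, e1]
  · push_cast; rw [← hr, ← hr, e2]; ring
  · push_cast; rw [← hr, ← hr, e3]; ring

/-- The intersection number of two cycles on the sphere vanishes. The summand is the local intersection
number at a positive crossing, once the second cycle is pushed slightly to one side. -/
theorem sum_intersection (hG : ∀ k, G.sign k = 1) (hP : G.IsPlanar)
    {χ ψ : Fin (2 * G.crossings + 1) → ℤ} (hχ : G.IsCirculation χ) (hψ : G.IsCirculation ψ) :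
    ∑ k, (χ (G.passage (k, true)).succ * ψ (G.passage (k, false)).succ
      - χ (G.passage (k, false)).castSucc * ψ (G.passage (k, true)).castSucc) = 0 := by
  obtain ⟨r, hr⟩ := exists_isIndex hG hP hχ
  have h1 : ∑ j : Fin (2 * G.crossings), (ψ j.succ * r j.succ - ψ j.castSucc * r j.castSucc)
      = 0 := by
    have a := Fin.sum_univ_succ fun e => ψ e * r e
    have b := Fin.sum_univ_castSucc fun e => ψ e * r e
    rw [Finset.sum_sub_distrib]
    rw [hψ.closed, hr.closed] at a
    linarith
  rw [← Equiv.sum_comp G.passage, Fintype.sum_prod_type] at h1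
  rw [← h1]
  refine Finset.sum_congr rfl fun k _ => ?_
  rw [Fintype.sum_bool, hr.over_out, hr.over_in, hr.under_out]
  linear_combination r (G.passage (k, false)).castSucc * hψ.conserve k

/-! ### Independence of the self-crossing count from the smoothing -/

variable (G) in
/-- The loop cut off by the crossing `k` on the knot: it consists of the edges between the two passages
through `k`, with sign `1` if the over-passage comes first and `-1` otherwise. -/
def loop (k : Fin G.crossings) (x : Fin (2 * G.crossings + 1)) : ℤ :=
  (if (G.passage (k, true)).castSucc < x then 1 else 0)
    - (if (G.passage (k, false)).castSucc < x then 1 else 0)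

theorem loop_succ_sub (k l : Fin G.crossings) (b : Bool) :
    G.loop k (G.passage (l, b)).succ - G.loop k (G.passage (l, b)).castSucc
      = if k = l then (if b then 1 else -1) else 0 := by
  have h : ∀ i j : Fin (2 * G.crossings),
      (if i.castSucc < j.succ then (1 : ℤ) else 0) - (if i.castSucc < j.castSucc then 1 else 0)
        = if i = j then 1 else 0 := by
    intro i j
    simp only [Fin.castSucc_lt_succ_iff, Fin.castSucc_lt_castSucc_iff]
    rcases lt_trichotomy i j with h | h | h
    · simp [h, h.le, h.ne]
    · simp [h]
    · simp [h.not_ge, h.not_gt, h.ne']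
  have h1 := h (G.passage (k, true)) (G.passage (l, b))
  have h2 := h (G.passage (k, false)) (G.passage (l, b))
  simp only [passage_inj] at h1 h2
  unfold loop
  cases b <;> by_cases hkl : k = l <;> simp [hkl] at h1 h2 ⊢ <;> omega

theorem isCirculation_loop (k : Fin G.crossings) : G.IsCirculation (G.loop k) := by
  refine ⟨by simp [loop, Fin.castSucc_lt_last], fun l => ?_⟩
  have h1 := loop_succ_sub k l true
  have h2 := loop_succ_sub k l false
  by_cases hkl : k = l <;> simp [hkl] at h1 h2 ⊢ <;> omega

theorem IsCirculation.eq_sum_loop {χ : Fin (2 * G.crossings + 1) → ℤ} (hχ : G.IsCirculation χ)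
    (x : Fin (2 * G.crossings + 1)) :
    χ x = χ 0 + ∑ k, (χ (G.passage (k, true)).succ - χ (G.passage (k, true)).castSucc)
      * G.loop k x := by
  induction x using Fin.induction with
  | zero => simp [loop]
  | succ j ih =>
    obtain ⟨l, b, rfl⟩ := exists_passage j
    have h : ∀ k, G.loop k (G.passage (l, b)).succ = G.loop k (G.passage (l, b)).castSucc
        + if k = l then (if b then 1 else -1) else 0 := fun k => by
      rw [← loop_succ_sub]; ring
    simp only [h, mul_add, Finset.sum_add_distrib, mul_ite, mul_zero, Finset.sum_ite_eq',
      Finset.mem_univ, if_true]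
    have := hχ.conserve l
    cases b <;> simp <;> linarith

theorem IsCirculation.sub {χ ψ : Fin (2 * G.crossings + 1) → ℤ} (hχ : G.IsCirculation χ)
    (hψ : G.IsCirculation ψ) : G.IsCirculation fun x => χ x - ψ x :=
  ⟨by rw [hχ.closed, hψ.closed], fun k => by linarith [hχ.conserve k, hψ.conserve k]⟩

/-- The intersection form vanishes on all of the tensor square of the space of circulations: `Δ` is
decomposed into products of circulations by expanding its columns in loops. -/
theorem sum_intersection_of_circulations (hG : ∀ k, G.sign k = 1) (hP : G.IsPlanar)
    {Δ : Fin (2 * G.crossings + 1) → Fin (2 * G.crossings + 1) → ℤ}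
    (hr : ∀ x, G.IsCirculation (Δ x)) (hc : ∀ y, G.IsCirculation fun x => Δ x y)
    (h0 : ∀ y, Δ 0 y = 0) :
    ∑ k, (Δ (G.passage (k, true)).succ (G.passage (k, false)).succ
      - Δ (G.passage (k, false)).castSucc (G.passage (k, true)).castSucc) = 0 := by
  have h : ∀ x y, Δ x y = ∑ l, G.loop l x
      * (Δ (G.passage (l, true)).succ y - Δ (G.passage (l, true)).castSucc y) := fun x y => by
    have := (hc y).eq_sum_loop x
    simp only [h0, zero_add] at this
    rw [this]
    exact Finset.sum_congr rfl fun _ _ => mul_comm _ _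
  have h' : ∀ k, Δ (G.passage (k, true)).succ (G.passage (k, false)).succ
      - Δ (G.passage (k, false)).castSucc (G.passage (k, true)).castSucc
      = ∑ l, (G.loop l (G.passage (k, true)).succ
        * (Δ (G.passage (l, true)).succ (G.passage (k, false)).succ
          - Δ (G.passage (l, true)).castSucc (G.passage (k, false)).succ)
        - G.loop l (G.passage (k, false)).castSucc
        * (Δ (G.passage (l, true)).succ (G.passage (k, true)).castSucc
          - Δ (G.passage (l, true)).castSucc (G.passage (k, true)).castSucc)) := fun k => by
    rw [Finset.sum_sub_distrib, ← h, ← h]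
  rw [Finset.sum_congr rfl fun k _ => h' k, Finset.sum_comm]
  exact Finset.sum_eq_zero fun l _ =>
    sum_intersection hG hP (isCirculation_loop l) ((hr _).sub (hr _))

section
variable {S : Finset (Fin G.crossings)} (hS : G.IsSingle S)

/-- The indicator function of the pairs of edges that the walk traverses in this order. -/
noncomputable def IsSingle.before (x y : Fin (2 * G.crossings + 1)) : ℤ :=
  if (hS.time x : ℕ) < hS.time y then 1 else 0

theorem IsSingle.time_out (k : Fin G.crossings) :
    k ∈ S ∧ (hS.time (G.passage (k, true)).succ : ℕ)
        = hS.time (G.passage (k, false)).castSucc + 1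
      ∧ (hS.time (G.passage (k, false)).succ : ℕ) = hS.time (G.passage (k, true)).castSucc + 1 ∨
    k ∉ S ∧ (hS.time (G.passage (k, true)).succ : ℕ) = hS.time (G.passage (k, true)).castSucc + 1
      ∧ (hS.time (G.passage (k, false)).succ : ℕ)
        = hS.time (G.passage (k, false)).castSucc + 1 := by
  have h1 := hS.time_succ (G.passage (k, true))
  have h2 := hS.time_succ (G.passage (k, false))
  rw [turn_passage] at h1 h2
  by_cases hk : k ∈ S
  · simp only [hk, if_true] at h1 h2
    exact Or.inl ⟨hk, h2, h1⟩
  · simp only [hk, if_false] at h1 h2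
    exact Or.inr ⟨hk, h1, h2⟩

theorem IsSingle.before_left (k : Fin G.crossings) (y : Fin (2 * G.crossings + 1)) :
    hS.before (G.passage (k, true)).castSucc y + hS.before (G.passage (k, false)).castSucc y
      = hS.before (G.passage (k, true)).succ y + hS.before (G.passage (k, false)).succ y
        + ((if y = (G.passage (k, true)).succ then 1 else 0)
          + if y = (G.passage (k, false)).succ then 1 else 0) := by
  simp only [before, ← hS.time_eq_iff (e := y)]
  rcases hS.time_out k with ⟨_, h1, h2⟩ | ⟨_, h1, h2⟩ <;> rw [h1, h2] <;> split_ifs <;> omega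

theorem IsSingle.before_right (k : Fin G.crossings) (x : Fin (2 * G.crossings + 1)) :
    hS.before x (G.passage (k, true)).succ + hS.before x (G.passage (k, false)).succ
      = hS.before x (G.passage (k, true)).castSucc + hS.before x (G.passage (k, false)).castSucc
        + ((if x = (G.passage (k, true)).castSucc then 1 else 0)
          + if x = (G.passage (k, false)).castSucc then 1 else 0) := by
  simp only [before, ← hS.time_eq_iff (e := x)]
  rcases hS.time_out k with ⟨_, h1, h2⟩ | ⟨_, h1, h2⟩ <;> rw [h1, h2] <;> split_ifs <;> omega

theorem IsSingle.before_zero_left (y : Fin (2 * G.crossings + 1)) :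
    hS.before 0 y = if y = 0 then 0 else 1 := by
  have := hS.time_eq_iff (e := y) (f := 0)
  rw [before, hS.time_zero]
  rw [hS.time_zero] at this
  split_ifs with h1 h2 h2 <;> first | rfl | (exfalso; simp_all)

theorem IsSingle.before_zero_right (x : Fin (2 * G.crossings + 1)) : hS.before x 0 = 0 := by
  simp [before]

theorem IsSingle.before_last_left (y : Fin (2 * G.crossings + 1)) :
    hS.before (Fin.last _) y = 0 := by
  have := (hS.time y).is_lt
  rw [before, hS.time_last, if_neg (by omega)]

theorem IsSingle.before_last_right (x : Fin (2 * G.crossings + 1)) :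
    hS.before x (Fin.last _) = if x = Fin.last _ then 0 else 1 := by
  have := hS.time_eq_iff (e := x) (f := Fin.last _)
  have h := (hS.time x).is_lt
  rw [hS.time_last] at this
  rw [before, hS.time_last]
  split_ifs with h1 h2 h2
  · simp_all
  · rfl
  · rfl
  · exact absurd (this.1 (by omega)) h2

/-- The ordered self-intersection number of the walk: a crossing that is not smoothed contributes `1` or
`-1` according to which strand comes first, and a smoothed one contributes nothing. -/
theorem IsSingle.sum_before [DecidablePred (G.UnderFirst S)] :
    ∑ k, (hS.before (G.passage (k, true)).succ (G.passage (k, false)).succ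
      - hS.before (G.passage (k, false)).castSucc (G.passage (k, true)).castSucc)
      = (G.crossings : ℤ) - S.card
        - 2 * (Finset.univ.filter fun k => k ∉ S ∧ G.UnderFirst S k).card := by
  have h : ∀ k, hS.before (G.passage (k, true)).succ (G.passage (k, false)).succ
      - hS.before (G.passage (k, false)).castSucc (G.passage (k, true)).castSucc
      = 1 - (if k ∈ S then 1 else 0) - 2 * (if k ∉ S ∧ G.UnderFirst S k then 1 else 0) := by
    intro k
    have hne : (hS.time (G.passage (k, true)).castSucc : ℕ)
        ≠ hS.time (G.passage (k, false)).castSucc := by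
      rw [Ne, hS.time_eq_iff, Fin.castSucc_inj, passage_inj]
      simp
    simp only [before, hS.underFirst_iff]
    rcases hS.time_out k with ⟨hk, h1, h2⟩ | ⟨hk, h1, h2⟩ <;> rw [h1, h2] <;>
      simp only [hk, not_true_eq_false, not_false_eq_true, false_and, true_and, if_true,
        if_false] <;> split_ifs <;> omega
  rw [Finset.sum_congr rfl fun k _ => h k, Finset.sum_sub_distrib, Finset.sum_sub_distrib,
    ← Finset.mul_sum, Finset.sum_boole, Finset.sum_boole]
  simp

end

/-- A form of Whitney's formula for the rotation number, which smoothing preserves: among the crossings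
that are not smoothed, the number of those met first on the over-strand minus the number of those met
first on the under-strand is the same for all sets `S` whose smoothing has one component. Indeed the
orders in which two such walks traverse the edges, as functions of two edges, differ by a function
that is a circulation in each variable. -/
theorem card_underFirst (hG : ∀ k, G.sign k = 1) (hP : G.IsPlanar)
    [∀ S, DecidablePred (G.UnderFirst S)] {S : Finset (Fin G.crossings)} (hS : G.IsSingle S) :
    S.card + 2 * (Finset.univ.filter fun k => k ∉ S ∧ G.UnderFirst S k).card
      = 2 * (Finset.univ.filter fun k => G.UnderFirst ∅ k).card := by
  have h0 := isSingle_empty (G := G)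
  have h := sum_intersection_of_circulations hG hP (Δ := fun x y => hS.before x y - h0.before x y)
    (fun x => ⟨by simp only [IsSingle.before_zero_right, IsSingle.before_last_right, sub_self],
      fun k => by linarith [hS.before_right k x, h0.before_right k x]⟩)
    (fun y => ⟨by simp only [IsSingle.before_zero_left, IsSingle.before_last_left, sub_self],
      fun k => by linarith [hS.before_left k y, h0.before_left k y]⟩)
    (fun y => by simp only [IsSingle.before_zero_left, sub_self])
  have h1 := hS.sum_before
  have h2 := h0.sum_before
  have h3 : ∀ a b c d : ℤ, a - b - (c - d) = a - c - (b - d) := fun a b c d => by ring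
  simp only [h3] at h
  rw [Finset.sum_sub_distrib, h1, h2] at h
  simp only [Finset.card_empty, Finset.notMem_empty, not_false_eq_true, true_and] at h
  push_cast at h
  omega

end GaussDiagram

/-! ### The skein relation for flow determinants -/

/-- The determinant as an alternating bilinear function of two of its rows. -/
theorem Matrix.det_updateRow_updateRow_sub {R n : Type*} [CommRing R] [Fintype n] [DecidableEq n]
    (M : Matrix n n R) {i j : n} (hij : i ≠ j) (e f a b : n → R) (α β γ δ : R) :
    ((M.updateRow i (e - (α • a + β • b))).updateRow j (f - (γ • a + δ • b))).det
      = ((M.updateRow i e).updateRow j f).det - γ * ((M.updateRow i e).updateRow j a).det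
        - δ * ((M.updateRow i e).updateRow j b).det - α * ((M.updateRow i a).updateRow j f).det
        - β * ((M.updateRow i b).updateRow j f).det
        + (α * δ - β * γ) * ((M.updateRow i a).updateRow j b).det := by
  have right (x v₁ v₂ v₃ : n → R) (c d : R) :
      ((M.updateRow i x).updateRow j (v₁ - (c • v₂ + d • v₃))).det
        = ((M.updateRow i x).updateRow j v₁).det - c * ((M.updateRow i x).updateRow j v₂).det
          - d * ((M.updateRow i x).updateRow j v₃).det := by
    have : v₁ - (c • v₂ + d • v₃) = v₁ + (-c) • v₂ + (-d) • v₃ := by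
      rw [neg_smul, neg_smul]; abel
    rw [this, det_updateRow_add, det_updateRow_add, det_updateRow_smul, det_updateRow_smul]
    ring
  have left (y v₁ v₂ v₃ : n → R) (c d : R) :
      ((M.updateRow i (v₁ - (c • v₂ + d • v₃))).updateRow j y).det
        = ((M.updateRow i v₁).updateRow j y).det - c * ((M.updateRow i v₂).updateRow j y).det
          - d * ((M.updateRow i v₃).updateRow j y).det := by
    have : v₁ - (c • v₂ + d • v₃) = v₁ + (-c) • v₂ + (-d) • v₃ := by
      rw [neg_smul, neg_smul]; abel
    simp only [updateRow_comm M hij]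
    rw [this, det_updateRow_add, det_updateRow_add, det_updateRow_smul, det_updateRow_smul]
    ring
  have self (x : n → R) : ((M.updateRow i x).updateRow j x).det = 0 :=
    det_zero_of_row_eq hij (by rw [updateRow_self, updateRow_ne hij, updateRow_self])
  have swap : ((M.updateRow i b).updateRow j a).det = -((M.updateRow i a).updateRow j b).det := by
    have h := self (0 - ((1 : R) • a + (1 : R) • b))
    rw [left, right, right, right, self, self] at h
    have z1 (y : n → R) : ((M.updateRow i 0).updateRow j y).det = 0 := by
      rw [updateRow_comm M hij]
      exact det_eq_zero_of_row_eq_zero i (by simp)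
    have z2 (x : n → R) : ((M.updateRow i x).updateRow j 0).det = 0 :=
      det_eq_zero_of_row_eq_zero j (by simp)
    rw [z2, z2] at h
    linear_combination h + z1 a + z1 b - self b
  rw [left, right, right, right, self, self, swap]
  ring

namespace GaussDiagram

open LaurentPolynomial

variable {G : GaussDiagram}

/-- What is done to a crossing of a positive diagram: it is kept, switched to a negative crossing, or
smoothed. -/
inductive Resolution
  | positive
  | negative
  | smoothed

/-- The value on the outgoing strand `b` as a combination of the values on the incoming strands `b'` has
the coefficients `x.coeff b b'`. A strand is named by its role in the original positive diagram, so
that `true` stands for the lower strand at a negative crossing. At crossings these are the Wirtinger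
relations with all generators sent to `t = T 2`, as in the Burau representation. -/
noncomputable def Resolution.coeff : Resolution → Bool → Bool → ℤ[T;T⁻¹]
  | positive, true, true => 1
  | positive, true, false => 0
  | positive, false, true => 1 - T 2
  | positive, false, false => T 2
  | negative, true, true => T (-2)
  | negative, true, false => 1 - T (-2)
  | negative, false, true => 0
  | negative, false, false => 1
  | smoothed, true, true => 0
  | smoothed, true, false => 1
  | smoothed, false, true => 1
  | smoothed, false, false => 0

variable (G) in
/-- The relation that gives the value on the edge leaving `k` on the strand `b`, as a linear form in the
values on the edges. -/
noncomputable def flowRow (x : Resolution) (k : Fin G.crossings) (b : Bool) :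
    Fin (2 * G.crossings + 1) → ℤ[T;T⁻¹] :=
  Pi.single (G.passage (k, b)).succ 1
    - (x.coeff b true • Pi.single (G.passage (k, true)).castSucc 1
      + x.coeff b false • Pi.single (G.passage (k, false)).castSucc 1)

variable (G) in
/-- The relations between the values on the edges, with one row for each outgoing edge. -/
noncomputable def flowMatrix (m : Fin G.crossings → Resolution) :
    Matrix (Fin (2 * G.crossings)) (Fin (2 * G.crossings + 1)) ℤ[T;T⁻¹] :=
  fun j => G.flowRow (m (G.passage.symm j).1) (G.passage.symm j).1 (G.passage.symm j).2

variable (G) in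
/-- The maximal minor of the flow matrix in which the column of the first edge is deleted. -/
noncomputable def flowDet (m : Fin G.crossings → Resolution) : ℤ[T;T⁻¹] :=
  ((G.flowMatrix m).submatrix id Fin.succ).det

theorem flowMatrix_passage (m : Fin G.crossings → Resolution) (k : Fin G.crossings) (b : Bool) :
    G.flowMatrix m (G.passage (k, b)) = G.flowRow (m k) k b := by simp [flowMatrix]

theorem flowRow_dotProduct (x : Resolution) (k : Fin G.crossings) (b : Bool)
    (v : Fin (2 * G.crossings + 1) → ℤ[T;T⁻¹]) :
    dotProduct (G.flowRow x k b) v = v (G.passage (k, b)).succ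
      - (x.coeff b true * v (G.passage (k, true)).castSucc
        + x.coeff b false * v (G.passage (k, false)).castSucc) := by
  simp [flowRow, sub_dotProduct, add_dotProduct, smul_dotProduct]

theorem T_two_mul_T_neg_two : (T 2 : ℤ[T;T⁻¹]) * T (-2) = 1 := by
  rw [← T_add]; simp

/-- The skein relation. It holds without planarity, because the `2 × 2` blocks `B` of the three resolutions
satisfy `B₊ = t B₋ + (1 - t) B₀` together with `det B₊ = t det B₋ + (1 - t) det B₀` and
`1 = t + (1 - t)`. -/
theorem flowDet_skein (m : Fin G.crossings → Resolution) (k : Fin G.crossings) :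
    G.flowDet (Function.update m k .positive)
      = T 2 * G.flowDet (Function.update m k .negative)
        + (1 - T 2) * G.flowDet (Function.update m k .smoothed) := by
  have hne : G.passage (k, true) ≠ G.passage (k, false) := by simp
  set M := (G.flowMatrix m).submatrix id Fin.succ with hM
  have h : ∀ x, G.flowDet (Function.update m k x)
      = ((M.updateRow (G.passage (k, true)) (G.flowRow x k true ∘ Fin.succ)).updateRow
          (G.passage (k, false)) (G.flowRow x k false ∘ Fin.succ)).det := by
    intro x
    rw [flowDet]
    congr 1
    refine funext fun j => ?_
    obtain ⟨l, b, rfl⟩ := exists_passage j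
    by_cases hl : l = k
    · subst hl
      have : ((G.flowMatrix (Function.update m l x)).submatrix id Fin.succ) (G.passage (l, b))
          = G.flowRow x l b ∘ Fin.succ := by
        funext i
        simp [flowMatrix_passage]
      rw [this]
      cases b
      · rw [Matrix.updateRow_self]
      · rw [Matrix.updateRow_ne hne, Matrix.updateRow_self]
    · rw [Matrix.updateRow_ne (by simp [hl]), Matrix.updateRow_ne (by simp [hl])]
      funext i
      simp [flowMatrix_passage, hl, hM]
  have h' : ∀ x b, G.flowRow x k b ∘ Fin.succ
      = (Pi.single (G.passage (k, b)).succ 1 : _ → ℤ[T;T⁻¹]) ∘ Fin.succ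
        - (x.coeff b true • ((Pi.single (G.passage (k, true)).castSucc 1 : _ → ℤ[T;T⁻¹]) ∘ Fin.succ)
        + x.coeff b false
          • ((Pi.single (G.passage (k, false)).castSucc 1 : _ → ℤ[T;T⁻¹]) ∘ Fin.succ)) :=
    fun x b => rfl
  simp only [h, h', Matrix.det_updateRow_updateRow_sub M hne, Resolution.coeff]
  generalize ((M.updateRow _ _).updateRow _ _).det = d₁
  generalize ((M.updateRow _ _).updateRow _ _).det = d₂
  generalize ((M.updateRow _ _).updateRow _ _).det = d₃
  generalize ((M.updateRow _ _).updateRow _ _).det = d₄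
  generalize ((M.updateRow _ _).updateRow _ _).det = d₅
  generalize ((M.updateRow _ _).updateRow _ _).det = d₆
  have ht := T_two_mul_T_neg_two
  linear_combination (d₄ - d₅ - d₆) * ht

/-! ### Flow determinants of descending resolutions -/

theorem flowMatrix_mulVec (m : Fin G.crossings → Resolution) (k : Fin G.crossings) (b : Bool)
    (v : Fin (2 * G.crossings + 1) → ℤ[T;T⁻¹]) :
    (G.flowMatrix m).mulVec v (G.passage (k, b)) = v (G.passage (k, b)).succ
      - ((m k).coeff b true * v (G.passage (k, true)).castSucc
        + (m k).coeff b false * v (G.passage (k, false)).castSucc) := by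
  rw [Matrix.mulVec, flowMatrix_passage, flowRow_dotProduct]

open Classical in
variable (G) in
/-- The resolution of a positive diagram that the walk has produced at time `i`: the crossings in `S` are
smoothed, those among the other crossings met so far which were met first on the under-strand are
switched, and everything else is kept. The part traversed so far is thus descending. -/
noncomputable def resolve (S : Finset (Fin G.crossings)) (i : ℕ) (k : Fin G.crossings) :
    Resolution :=
  if k ∈ S then .smoothed else if k ∈ G.met S i ∧ G.UnderFirst S k then .negative else .positive

theorem resolve_of_mem {S : Finset (Fin G.crossings)} (i : ℕ) {k : Fin G.crossings} (hk : k ∈ S) :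
    G.resolve S i k = .smoothed := if_pos hk

theorem resolve_of_underFirst {S : Finset (Fin G.crossings)} {i : ℕ} {k : Fin G.crossings}
    (hk : k ∉ S) (hm : k ∈ G.met S i) (hu : G.UnderFirst S k) : G.resolve S i k = .negative :=
  (if_neg hk).trans (if_pos ⟨hm, hu⟩)

theorem resolve_of_not {S : Finset (Fin G.crossings)} {i : ℕ} {k : Fin G.crossings}
    (hk : k ∉ S) (h : ¬ (k ∈ G.met S i ∧ G.UnderFirst S k)) : G.resolve S i k = .positive :=
  (if_neg hk).trans (if_neg h)

theorem flowDet_eq_zero {m : Fin G.crossings → Resolution}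
    {v : Fin (2 * G.crossings + 1) → ℤ[T;T⁻¹]} (h0 : v 0 = 0) (hv : v ≠ 0)
    (h : ∀ k b, v (G.passage (k, b)).succ
      = (m k).coeff b true * v (G.passage (k, true)).castSucc
        + (m k).coeff b false * v (G.passage (k, false)).castSucc) : G.flowDet m = 0 := by
  refine Matrix.exists_mulVec_eq_zero_iff.1 ⟨v ∘ Fin.succ, fun hs => hv ?_, ?_⟩
  · funext e
    induction e using Fin.cases with
    | zero => exact h0
    | succ j => exact congrFun hs j
  · funext j
    have h1 : (G.flowMatrix m).mulVec v j = 0 := by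
      obtain ⟨k, b, rfl⟩ := exists_passage j
      rw [flowMatrix_mulVec, h, sub_self]
    rw [Matrix.mulVec, dotProduct, Fin.sum_univ_succ, h0, mul_zero, zero_add] at h1
    exact h1

/-- The edges that the walk traverses. -/
def visited (S : Finset (Fin G.crossings)) : Set (Fin (2 * G.crossings + 1)) :=
  Set.range (G.walk S)

theorem turn_succ_mem_visited {S : Finset (Fin G.crossings)} {j : Fin (2 * G.crossings)} :
    (G.turn S j).succ ∈ visited S ↔ j.castSucc ∈ visited S := by
  constructor
  · rintro ⟨i, hi⟩
    obtain ⟨a, _, ha⟩ := exists_walk_castSucc hi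
    exact ⟨a, by rw [ha, turn_turn]⟩
  · rintro ⟨i, hi⟩
    exact ⟨i + 1, by rw [walk_succ, hi, step_castSucc]⟩

theorem out_mem_visited_of_mem {S : Finset (Fin G.crossings)} {k : Fin G.crossings} (hk : k ∈ S)
    (b : Bool) :
    (G.passage (k, b)).succ ∈ visited S ↔ (G.passage (k, !b)).castSucc ∈ visited S := by
  rw [← turn_succ_mem_visited, turn_passage, if_pos hk, Bool.not_not]

theorem out_mem_visited_of_notMem {S : Finset (Fin G.crossings)} {k : Fin G.crossings}
    (hk : k ∉ S) (b : Bool) :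
    (G.passage (k, b)).succ ∈ visited S ↔ (G.passage (k, b)).castSucc ∈ visited S := by
  rw [← turn_succ_mem_visited, turn_passage, if_neg hk]

theorem zero_mem_visited (S : Finset (Fin G.crossings)) : 0 ∈ visited S := ⟨0, rfl⟩

theorem last_mem_visited (S : Finset (Fin G.crossings)) : Fin.last _ ∈ visited S :=
  ⟨_, walk_eq_last S le_rfl⟩

open Classical in
theorem isCirculation_visited (S : Finset (Fin G.crossings)) :
    G.IsCirculation fun e => if e ∈ visited S then 1 else 0 := by
  refine ⟨by simp [zero_mem_visited, last_mem_visited], fun k => ?_⟩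
  by_cases hk : k ∈ S
  · simp only [out_mem_visited_of_mem hk, Bool.not_true, Bool.not_false]
    exact add_comm _ _
  · simp only [out_mem_visited_of_notMem hk]

/-- If the base component misses some edge at the end of its walk, it lies above the other components. Then
`0` on the base component and `t ^ r` elsewhere, with `r` the winding number of the base component,
is a nontrivial solution of all relations. -/
theorem flowDet_resolve_of_not_isSingle (hG : ∀ k, G.sign k = 1) (hP : G.IsPlanar)
    {S : Finset (Fin G.crossings)} {i : ℕ} (hi : 2 * G.crossings ≤ i) (hS : ¬ G.IsSingle S) :
    G.flowDet (G.resolve S i) = 0 := by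
  classical
  obtain ⟨r, hr⟩ := exists_isIndex hG hP (isCirculation_visited S)
  refine flowDet_eq_zero (v := fun e => if e ∈ visited S then 0 else T (2 * r e))
    (if_pos (zero_mem_visited S)) ?_ fun k b => ?_
  · obtain ⟨e, he⟩ := not_forall.1 hS
    intro h
    have h1 := congrFun h e
    simp only [if_neg (show e ∉ visited S from he), Pi.zero_apply] at h1
    exact (isUnit_T (R := ℤ) _).ne_zero h1
  · have r1 := hr.over_out k
    have r2 := hr.over_in k
    have r3 := hr.under_out k
    by_cases hk : k ∈ S
    · simp only [out_mem_visited_of_mem hk] at r2 r3 ⊢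
      rw [resolve_of_mem i hk]
      cases b
      · simp only [Resolution.coeff, Bool.not_false, Bool.not_true] at r3 ⊢
        rw [one_mul, zero_mul, add_zero, r2, r3]
      · simp only [Resolution.coeff, Bool.not_true] at r3 ⊢
        rw [one_mul, zero_mul, zero_add, r1]
    · simp only [out_mem_visited_of_notMem hk] at r2 r3 ⊢
      by_cases ho : (G.passage (k, true)).castSucc ∈ visited S <;>
        by_cases hu : (G.passage (k, false)).castSucc ∈ visited S
      · cases b <;> simp [ho, hu]
      · have hn : ¬ G.UnderFirst S k := fun ⟨a, ha, _⟩ => hu ⟨a, ha⟩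
        rw [resolve_of_not hk fun h => hn h.2]
        cases b
        · simp only [ho, hu, if_true, if_false, Resolution.coeff] at r3 ⊢
          rw [mul_zero, zero_add, ← T_add, r3]
          congr 1
          ring
        · simp [ho, hu, Resolution.coeff]
      · have hn : G.UnderFirst S k := by
          obtain ⟨a, ha⟩ := hu
          exact ⟨a, ha, fun j _ hj => ho ⟨j, hj⟩⟩
        have hm : k ∈ G.met S i := by
          obtain ⟨a, ha⟩ := hu
          exact mem_met_of_walk hi ha
        rw [resolve_of_underFirst hk hm hn]
        cases b
        · simp [ho, hu, Resolution.coeff]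
        · simp only [ho, hu, if_true, if_false, Resolution.coeff] at r2 ⊢
          rw [mul_zero, add_zero, ← T_add, r1, r2]
          congr 1
          ring
      · simp only [ho, hu, if_false, add_zero] at r2 r3 ⊢
        have hsum : ∀ x : Resolution, x.coeff b true + x.coeff b false = 1 := by
          intro x
          cases x <;> cases b <;> simp [Resolution.coeff]
        cases b <;> simp only [ho, hu, if_false]
        · rw [r3, r2, ← add_mul, hsum, one_mul]
        · rw [r1, r2, ← add_mul, hsum, one_mul]

/-- For a descending diagram with one component the relations give the value on each edge in terms of
earlier edges, so the matrix is unitriangular in the order of the walk. -/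
theorem flowDet_resolve_of_isSingle {S : Finset (Fin G.crossings)} {i : ℕ}
    (hi : 2 * G.crossings ≤ i) (hS : G.IsSingle S) : G.flowDet (G.resolve S i) = 1 := by
  classical
  -- `σ a` is the endpoint from which the walk departs at time `a + 1`.
  have hpos : ∀ a : Fin (2 * G.crossings), ∃ j : Fin (2 * G.crossings),
      G.walk S (a + 1) = j.succ := fun a => by
    have h : G.walk S (a + 1) ≠ 0 := fun h => by
      have := hS.time_walk (i := a + 1) a.is_lt
      rw [h, hS.time_zero] at this
      omega
    obtain ⟨j, hj⟩ := Fin.exists_succ_eq.2 h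
    exact ⟨j, hj.symm⟩
  choose σ hσ using hpos
  have hσt : ∀ a, (hS.time (σ a).succ : ℕ) = a + 1 := fun a => by
    rw [← hσ, hS.time_walk a.is_lt]
  have hinj : Function.Injective σ := fun a b hab => by
    have h1 := hσt a
    rw [hab, hσt b] at h1
    exact Fin.ext (by omega)
  let e : Fin (2 * G.crossings) ≃ Fin (2 * G.crossings) :=
    Equiv.ofBijective σ (Finite.injective_iff_bijective.1 hinj)
  have key : ∀ a b, a ≤ b → G.flowMatrix (G.resolve S i) (σ a) (σ b).succ
      = if a = b then 1 else 0 := by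
    intro a b hab
    obtain ⟨k, o, hk⟩ := exists_passage (σ a)
    have ha : (hS.time (σ a).succ : ℕ) ≤ hS.time (σ b).succ := by
      rw [hσt, hσt]; exact Nat.succ_le_succ hab
    rw [← hk, flowMatrix_passage, flowRow]
    have h0 : (Pi.single (G.passage (k, o)).succ 1 : _ → ℤ[T;T⁻¹]) (σ b).succ
        = if a = b then 1 else 0 := by
      rw [hk, Pi.single_apply]
      simp only [Fin.succ_inj, hinj.eq_iff, eq_comm]
    have h1 : ∀ o', (hS.time (G.passage (k, o')).castSucc : ℕ) < hS.time (σ a).succ →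
        (Pi.single (G.passage (k, o')).castSucc 1 : _ → ℤ[T;T⁻¹]) (σ b).succ = 0 := by
      intro o' ho'
      refine Pi.single_eq_of_ne (fun h => ?_) 1
      rw [h] at ha
      omega
    rw [← hk] at h1
    simp only [Pi.sub_apply, Pi.add_apply, Pi.smul_apply, smul_eq_mul, h0]
    have hu := hS.underFirst_iff (k := k)
    have hm : k ∈ G.met S i := mem_met_of_walk hi (hS.walk_time (G.passage (k, true)).castSucc)
    rcases hS.time_out k with ⟨hkS, t1, t2⟩ | ⟨hkS, t1, t2⟩
    · rw [resolve_of_mem i hkS]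
      cases o
      · rw [h1 true (by omega)]; simp [Resolution.coeff]
      · rw [h1 false (by omega)]; simp [Resolution.coeff]
    · by_cases huf : G.UnderFirst S k
      · rw [resolve_of_underFirst hkS hm huf]
        rw [hu] at huf
        cases o
        · rw [h1 false (by omega)]; simp [Resolution.coeff]
        · rw [h1 false (by omega), h1 true (by omega)]; simp
      · rw [resolve_of_not hkS fun h => huf h.2]
        rw [hu, not_lt] at huf
        cases o
        · have : (hS.time (G.passage (k, true)).castSucc : ℕ)
              ≠ hS.time (G.passage (k, false)).castSucc := by
            rw [Ne, hS.time_eq_iff, Fin.castSucc_inj, passage_inj]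
            simp
          rw [h1 false (by omega), h1 true (by omega)]; simp
        · rw [h1 true (by omega)]; simp [Resolution.coeff]
  rw [flowDet, ← Matrix.det_submatrix_equiv_self e, Matrix.det_of_isLowerTriangular]
  · exact Finset.prod_eq_one fun a _ => (key a a le_rfl).trans (if_pos rfl)
  · intro a b hab
    have hab' : a < b := hab
    exact (key a b hab'.le).trans (if_neg hab'.ne)

/-! ### Expansion over the admissible sets -/

theorem met_succ_of_last {S : Finset (Fin G.crossings)} {i : ℕ}
    (h : G.walk S i = Fin.last _) : G.met S (i + 1) = G.met S i := by
  refine (met_mono S (Nat.le_succ i)).antisymm' fun k hk => ?_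
  obtain ⟨j, hj, b, hb⟩ := mem_met.1 hk
  refine mem_met.2 ⟨j, ?_, b, hb⟩
  rcases Nat.lt_succ_iff_lt_or_eq.1 hj with hj | rfl
  · exact hj
  · rw [h] at hb
    exact absurd hb (Fin.castSucc_lt_last _).ne'

theorem met_succ {S : Finset (Fin G.crossings)} {i : ℕ} {k : Fin G.crossings} {b : Bool}
    (h : G.walk S i = (G.passage (k, b)).castSucc) : G.met S (i + 1) = insert k (G.met S i) := by
  ext l
  rw [Finset.mem_insert, mem_met, mem_met]
  constructor
  · rintro ⟨j, hj, b', hb⟩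
    rcases Nat.lt_succ_iff_lt_or_eq.1 hj with hj | rfl
    · exact Or.inr ⟨j, hj, b', hb⟩
    · rw [h, Fin.castSucc_inj, passage_inj] at hb
      exact Or.inl hb.1.symm
  · rintro (rfl | ⟨j, hj, b', hb⟩)
    · exact ⟨i, by omega, b, h⟩
    · exact ⟨j, by omega, b', hb⟩

theorem not_underFirst_of_over {S : Finset (Fin G.crossings)} {i : ℕ} {k : Fin G.crossings}
    (hk : k ∉ G.met S i) (h : G.walk S i = (G.passage (k, true)).castSucc) :
    ¬ G.UnderFirst S k := by
  rintro ⟨a, ha, hb⟩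
  refine hk (mem_met.2 ⟨a, ?_, false, ha⟩)
  by_contra hai
  exact hb i (by omega) h

theorem underFirst_of_under {S : Finset (Fin G.crossings)} {i : ℕ} {k : Fin G.crossings}
    (hk : k ∉ G.met S i) (h : G.walk S i = (G.passage (k, false)).castSucc) :
    G.UnderFirst S k := by
  refine ⟨i, h, fun j hj hb => ?_⟩
  rcases hj.lt_or_eq with hj | rfl
  · exact hk (mem_met.2 ⟨j, hj, true, hb⟩)
  · rw [h, Fin.castSucc_inj, passage_inj] at hb
    simp at hb

open Classical in
variable (G) in
/-- The contribution of the admissible set `S` that arises at the crossings outside `V`: a factor `1 - t`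
for each smoothed crossing and a factor `t` for each switched one. -/
noncomputable def weight (V S : Finset (Fin G.crossings)) : ℤ[T;T⁻¹] :=
  (1 - T 2) ^ (S \ V).card
    * T 2 ^ (Finset.univ.filter fun k => k ∉ S ∧ k ∉ V ∧ G.UnderFirst S k).card

open Classical in
variable (G) in
/-- The admissible sets that agree with `S₀` on `V`. -/
noncomputable def extensions (V S₀ : Finset (Fin G.crossings)) : Finset (Finset (Fin G.crossings)) :=
  Finset.univ.filter fun S => G.Admissible S ∧ ∀ k ∈ V, (k ∈ S ↔ k ∈ S₀)

theorem mem_extensions {V S₀ S : Finset (Fin G.crossings)} :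
    S ∈ G.extensions V S₀ ↔ G.Admissible S ∧ ∀ k ∈ V, (k ∈ S ↔ k ∈ S₀) := by
  simp [extensions]

theorem resolve_congr {S S' : Finset (Fin G.crossings)} {i j : ℕ} {k : Fin G.crossings}
    (h : k ∈ S ↔ k ∈ S')
    (h' : k ∈ G.met S i ∧ G.UnderFirst S k ↔ k ∈ G.met S' j ∧ G.UnderFirst S' k) :
    G.resolve S i k = G.resolve S' j k := by
  unfold resolve
  split_ifs <;> first | rfl | (exfalso; tauto)

theorem flowDet_terminal (hG : ∀ k, G.sign k = 1) (hP : G.IsPlanar)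
    {S₀ : Finset (Fin G.crossings)} {i : ℕ} (hi : 2 * G.crossings ≤ i)
    (hmet : S₀ ⊆ G.met S₀ i) (hu : ∀ k ∈ S₀, G.UnderFirst S₀ k) :
    G.flowDet (G.resolve S₀ i)
      = ∑ S ∈ G.extensions (G.met S₀ i) S₀, G.weight (G.met S₀ i) S := by
  by_cases hS : G.IsSingle S₀
  · have hV : G.met S₀ i = Finset.univ := by
      ext k
      simp only [Finset.mem_univ, iff_true]
      exact mem_met_of_walk hi (hS.walk_time (G.passage (k, true)).castSucc)
    have he : G.extensions (G.met S₀ i) S₀ = {S₀} := by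
      ext S
      rw [mem_extensions, hV, Finset.mem_singleton]
      constructor
      · rintro ⟨_, h⟩
        exact Finset.ext fun k => h k (Finset.mem_univ k)
      · rintro rfl
        exact ⟨⟨hS, hu⟩, fun _ _ => Iff.rfl⟩
    rw [flowDet_resolve_of_isSingle hi hS, he, Finset.sum_singleton, hV]
    simp [weight, Finset.sdiff_eq_empty_iff_subset.2 (Finset.subset_univ S₀)]
  · rw [flowDet_resolve_of_not_isSingle hG hP hi hS]
    symm
    convert Finset.sum_empty
    refine Finset.eq_empty_of_forall_notMem fun S h => hS ?_
    rw [mem_extensions] at h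
    have hw : ∀ j, G.walk S j = G.walk S₀ j := fun j => by
      by_cases hj : j ≤ i
      · exact walk_congr h.2 hj
      · rw [walk_eq_last S (by omega), walk_eq_last S₀ (by omega)]
    intro e
    obtain ⟨j, hj⟩ := h.1.isSingle e
    exact ⟨j, by rw [← hw, hj]⟩

/-- The expansion of the flow determinant from time `i` on, by induction on the number `n` of steps that
remain: when the walk arrives at a new crossing on the under-strand, the skein relation splits the
sum over the extensions according to whether the crossing is smoothed or switched. -/
theorem flowDet_resolve (hG : ∀ k, G.sign k = 1) (hP : G.IsPlanar) (n : ℕ)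
    {S₀ : Finset (Fin G.crossings)} {i : ℕ} (hi : 2 * G.crossings ≤ i + n)
    (hmet : S₀ ⊆ G.met S₀ i) (hu : ∀ k ∈ S₀, G.UnderFirst S₀ k) :
    G.flowDet (G.resolve S₀ i)
      = ∑ S ∈ G.extensions (G.met S₀ i) S₀, G.weight (G.met S₀ i) S := by
  classical
  induction n generalizing S₀ i with
  | zero => exact flowDet_terminal hG hP hi hmet hu
  | succ n ih =>
    have ih0 := ih (S₀ := S₀) (i := i + 1) (by omega)
      (hmet.trans (met_mono _ (Nat.le_succ i))) hu
    have same : G.met S₀ (i + 1) = G.met S₀ i → G.flowDet (G.resolve S₀ i)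
        = ∑ S ∈ G.extensions (G.met S₀ i) S₀, G.weight (G.met S₀ i) S := by
      intro h
      have hres : G.resolve S₀ i = G.resolve S₀ (i + 1) := by
        funext k
        rw [resolve, resolve, h]
      rw [hres, ih0, h]
    by_cases hl : G.walk S₀ i = Fin.last _
    · exact same (met_succ_of_last hl)
    obtain ⟨j, hj⟩ := Fin.exists_castSucc_eq.2 hl
    obtain ⟨k, b, rfl⟩ := exists_passage j
    have hV' := met_succ hj.symm
    by_cases hk : k ∈ G.met S₀ i
    · exact same (by rw [hV', Finset.insert_eq_of_mem hk])
    have hkS₀ : k ∉ S₀ := fun h => hk (hmet h)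
    set V := G.met S₀ i with hV
    cases b with
    | true =>
      have hnu := not_underFirst_of_over hk hj.symm
      have hres : G.resolve S₀ i = G.resolve S₀ (i + 1) := by
        funext l
        by_cases hl : l = k
        · subst hl
          rw [resolve_of_not hkS₀ fun h => hnu h.2, resolve_of_not hkS₀ fun h => hnu h.2]
        · exact resolve_congr Iff.rfl (by rw [hV', Finset.mem_insert, or_iff_right hl])
      have hext : G.extensions (insert k V) S₀ = G.extensions V S₀ := by
        ext S
        rw [mem_extensions, mem_extensions, Finset.forall_mem_insert]
        refine and_congr_right fun hS => ⟨fun h => h.2, fun h => ⟨?_, h⟩⟩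
        refine iff_of_false (fun hkS => hnu ?_) hkS₀
        refine (underFirst_congr h ?_).1 (hS.underFirst k hkS)
        rw [hV']
        exact Finset.mem_insert_self _ _
      rw [hres, ih0, hV', hext]
      refine Finset.sum_congr rfl fun S hS => ?_
      rw [mem_extensions] at hS
      have hnu' : ¬ G.UnderFirst S k := fun h => hnu
        ((underFirst_congr hS.2 (by rw [hV']; exact Finset.mem_insert_self _ _)).1 h)
      have hkS : k ∉ S := fun h => hnu' (hS.1.underFirst k h)
      rw [weight, weight, Finset.sdiff_insert_of_notMem hkS]
      congr 3
      ext l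
      simp only [Finset.mem_filter, Finset.mem_univ, true_and, Finset.mem_insert, not_or]
      constructor
      · rintro ⟨h1, h2, h3⟩
        exact ⟨h1, h2.2, h3⟩
      · rintro ⟨h1, h2, h3⟩
        exact ⟨h1, ⟨fun h => hnu' (h ▸ h3), h2⟩, h3⟩
    | false =>
      have huk := underFirst_of_under hk hj.symm
      -- Both choices at the new crossing leave the walk up to now unchanged.
      have hagree : ∀ l ∈ V, (l ∈ insert k S₀ ↔ l ∈ S₀) := fun l hl => by
        rw [Finset.mem_insert, or_iff_right (by rintro rfl; exact hk hl)]
      have hmet1 : G.met (insert k S₀) (i + 1) = insert k V := by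
        rw [met_congr hagree le_rfl, hV']
      have hu1 : ∀ l ∈ insert k V, (G.UnderFirst (insert k S₀) l ↔ G.UnderFirst S₀ l) :=
        fun l hl => underFirst_congr hagree (by rwa [hV'])
      have ih1 := ih (S₀ := insert k S₀) (i := i + 1) (by omega)
        (by rw [hmet1]; exact Finset.insert_subset_insert _ hmet)
        (fun l hl => (hu1 l (Finset.insert_subset_insert _ hmet hl)).2 (by
          rcases Finset.mem_insert.1 hl with rfl | hl
          · exact huk
          · exact hu l hl))
      rw [hmet1] at ih1
      rw [hV'] at ih0
      have hr0 : G.resolve S₀ i = Function.update (G.resolve S₀ i) k .positive := by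
        rw [eq_comm, Function.update_eq_self_iff]
        exact (resolve_of_not hkS₀ fun h => hk h.1).symm
      have hr1 : G.resolve S₀ (i + 1) = Function.update (G.resolve S₀ i) k .negative := by
        funext l
        by_cases hl : l = k
        · subst hl
          rw [Function.update_self]
          exact resolve_of_underFirst hkS₀ (by rw [hV']; exact Finset.mem_insert_self _ _) huk
        · rw [Function.update_of_ne hl]
          exact resolve_congr Iff.rfl (by rw [hV', Finset.mem_insert, or_iff_right hl])
      have hr2 : G.resolve (insert k S₀) (i + 1)
          = Function.update (G.resolve S₀ i) k .smoothed := by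
        funext l
        by_cases hl : l = k
        · subst hl
          rw [Function.update_self]
          exact resolve_of_mem _ (Finset.mem_insert_self _ _)
        · rw [Function.update_of_ne hl]
          refine resolve_congr (by rw [Finset.mem_insert, or_iff_right hl]) ?_
          rw [hmet1, Finset.mem_insert, or_iff_right hl]
          exact and_congr_right fun hlV => hu1 l (Finset.mem_insert_of_mem hlV)
      rw [hr0, flowDet_skein, ← hr1, ← hr2, ih0, ih1, Finset.mul_sum, Finset.mul_sum]
      rw [← Finset.sum_filter_not_add_sum_filter (G.extensions V S₀) (fun S => k ∈ S)]
      congr 1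
      · have hset : (G.extensions V S₀).filter (fun S => k ∉ S)
            = G.extensions (insert k V) S₀ := by
          ext S
          rw [Finset.mem_filter, mem_extensions, mem_extensions, Finset.forall_mem_insert,
            iff_false_right hkS₀]
          tauto
        rw [hset]
        refine Finset.sum_congr rfl fun S hS => ?_
        · rw [mem_extensions, Finset.forall_mem_insert, iff_false_right hkS₀] at hS
          have hkS := hS.2.1
          have huS : G.UnderFirst S k := (underFirst_congr hS.2.2
            (by rw [hV']; exact Finset.mem_insert_self _ _)).2 huk
          rw [weight, weight, Finset.sdiff_insert_of_notMem hkS]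
          have : (Finset.univ.filter fun l => l ∉ S ∧ l ∉ V ∧ G.UnderFirst S l)
              = insert k (Finset.univ.filter fun l => l ∉ S ∧ l ∉ insert k V ∧ G.UnderFirst S l) := by
            ext l
            by_cases hl : l = k
            · subst hl; simp [hkS, hk, huS]
            · simp [hl]
          rw [this, Finset.card_insert_of_notMem (by simp), pow_succ]
          ring
      · have hset : (G.extensions V S₀).filter (fun S => k ∈ S)
            = G.extensions (insert k V) (insert k S₀) := by
          ext S
          rw [Finset.mem_filter, mem_extensions, mem_extensions, Finset.forall_mem_insert,
            iff_true_right (Finset.mem_insert_self _ _)]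
          constructor
          · rintro ⟨⟨h1, h3⟩, h2⟩
            exact ⟨h1, h2, fun l hl => (h3 l hl).trans (hagree l hl).symm⟩
          · rintro ⟨h1, h2, h3⟩
            exact ⟨⟨h1, fun l hl => (h3 l hl).trans (hagree l hl)⟩, h2⟩
        rw [hset]
        refine Finset.sum_congr rfl fun S hS => ?_
        · rw [mem_extensions, Finset.forall_mem_insert,
            iff_true_right (Finset.mem_insert_self _ _)] at hS
          have hkS := hS.2.1
          have h1 : S \ V = insert k (S \ insert k V) := by
            ext l
            by_cases hl : l = k
            · subst hl; simp [hkS, hk]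
            · simp [hl]
          have h2 : (Finset.univ.filter fun l => l ∉ S ∧ l ∉ V ∧ G.UnderFirst S l)
              = Finset.univ.filter fun l => l ∉ S ∧ l ∉ insert k V ∧ G.UnderFirst S l := by
            ext l
            by_cases hl : l = k
            · subst hl; simp [hkS]
            · simp [hl]
          rw [weight, weight, h1, h2, Finset.card_insert_of_notMem (by simp), pow_succ]
          ring

open Classical in
theorem flowDet_positive (hG : ∀ k, G.sign k = 1) (hP : G.IsPlanar) :
    G.flowDet (fun _ => .positive)
      = ∑ S with G.Admissible S, (1 - T 2) ^ S.card
        * T 2 ^ (Finset.univ.filter fun k => k ∉ S ∧ G.UnderFirst S k).card := by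
  have h0 : G.met ∅ 0 = ∅ := by
    ext k; simp [mem_met]
  have h := flowDet_resolve hG hP (2 * G.crossings) (S₀ := ∅) (i := 0) (by omega) (by simp) (by simp)
  have hr : G.resolve ∅ 0 = fun _ => .positive := by
    funext k
    exact resolve_of_not (by simp) (by simp [h0])
  rw [hr, h0] at h
  rw [h]
  refine Finset.sum_congr ?_ fun S _ => ?_
  · ext S
    simp [mem_extensions]
  · simp [weight]

/-! ### The Alexander matrix -/

variable (G) in
/-- The Wirtinger relations in terms of the increments of the values at the under-passages. -/
noncomputable def passageMatrix : Matrix (Fin G.crossings) (Fin G.crossings) ℤ[T;T⁻¹] :=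
  Matrix.of fun k l => (if l = k then 1 else 0)
    + (1 - T 2) * ((if G.passage (l, false) < G.passage (k, false) then 1 else 0)
      - if G.passage (l, false) < G.passage (k, true) then 1 else 0)

theorem ite_le_eq_add {R α : Type*} [AddMonoidWithOne R] [LinearOrder α] (i j : α) :
    (if i ≤ j then (1 : R) else 0) = (if i = j then 1 else 0) + if i < j then 1 else 0 := by
  rcases lt_trichotomy i j with h | h | h
  · simp [h, h.le, h.ne]
  · simp [h]
  · simp [h.not_ge, h.not_gt, h.ne']

/-- The lower triangular matrix of ones, which passes from increments to values, has determinant `1`. -/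
theorem det_ite_le {R : Type*} [CommRing R] (n : ℕ) :
    (Matrix.of fun i j : Fin n => if j ≤ i then (1 : R) else 0).det = 1 := by
  rw [Matrix.det_of_isLowerTriangular]
  · simp
  · intro i j hij
    have hij' : i < j := hij
    simp [hij'.not_ge]

theorem submatrix_succ_mul {R m n : Type*} [CommRing R] {N : ℕ} (A : Matrix m (Fin (N + 1)) R)
    {B : Matrix (Fin (N + 1)) n R} (h : ∀ j, B 0 j = 0) :
    A.submatrix id Fin.succ * B.submatrix Fin.succ id = A * B := by
  ext i j
  simp [Matrix.mul_apply, Fin.sum_univ_succ, h]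

theorem flowDet_positive_eq_det : G.flowDet (fun _ => .positive) = G.passageMatrix.det := by
  let P : Matrix (Fin (2 * G.crossings + 1)) (Fin (2 * G.crossings)) ℤ[T;T⁻¹] :=
    Matrix.of fun e j => if j.castSucc < e then 1 else 0
  have hP0 : ∀ j, P 0 j = 0 := fun j => by simp [P]
  have hP1 : (P.submatrix Fin.succ id).det = 1 := by
    rw [← det_ite_le (R := ℤ[T;T⁻¹]) (2 * G.crossings)]
    congr 1
    ext1 i j
    simp only [P, Matrix.submatrix_apply, id, Fin.castSucc_lt_succ_iff, Matrix.of_apply]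
  have hmul : ∀ k b j, (G.flowMatrix (fun _ => .positive) * P) (G.passage (k, b)) j
      = (if j = G.passage (k, b) then 1 else 0) + if b then 0 else
        (1 - T 2) * ((if j < G.passage (k, false) then 1 else 0)
          - if j < G.passage (k, true) then 1 else 0) := by
    intro k b j
    have h : (G.flowMatrix (fun _ => .positive) * P) (G.passage (k, b)) j
        = (G.flowMatrix (fun _ => .positive)).mulVec (fun e => P e j) (G.passage (k, b)) := rfl
    rw [h, flowMatrix_mulVec]
    simp only [P, Matrix.of_apply, Fin.castSucc_lt_succ_iff, Fin.castSucc_lt_castSucc_iff, ite_le_eq_add]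
    cases b <;> simp only [Resolution.coeff, Bool.false_eq_true, if_false, if_true] <;> ring
  let E : Fin G.crossings ⊕ Fin G.crossings ≃ Fin (2 * G.crossings) :=
    (Equiv.boolProdEquivSum _).symm.trans ((Equiv.prodComm _ _).trans G.passage)
  have hE1 : ∀ k, E (Sum.inl k) = G.passage (k, false) := fun k => rfl
  have hE2 : ∀ k, E (Sum.inr k) = G.passage (k, true) := fun k => rfl
  have hblock : (G.flowMatrix (fun _ => .positive) * P).submatrix E E
      = Matrix.fromBlocks G.passageMatrix
        (Matrix.of fun k l => (1 - T 2) * ((if G.passage (l, true) < G.passage (k, false) then 1 else 0)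
          - if G.passage (l, true) < G.passage (k, true) then 1 else 0)) 0 1 := by
    ext1 x y
    rcases x with k | k <;> rcases y with l | l <;>
      simp [hE1, hE2, hmul, passageMatrix, Matrix.one_apply, eq_comm]
  rw [flowDet, ← mul_one (Matrix.det _), ← hP1, ← Matrix.det_mul, submatrix_succ_mul _ hP0,
    ← Matrix.det_submatrix_equiv_self E, hblock, Matrix.det_fromBlocks_zero₂₁, Matrix.det_one,
    mul_one]

theorem arc_val (j : Fin (2 * G.crossings)) :
    (G.arc j : ℕ) = (Finset.univ.filter fun k => G.passage (k, false) < j).card := rfl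

theorem arc_lt_arc_iff {k : Fin G.crossings} {j : Fin (2 * G.crossings)} :
    G.arc (G.passage (k, false)) < G.arc j ↔ G.passage (k, false) < j := by
  rw [Fin.lt_def, arc_val, arc_val]
  constructor
  · intro h
    by_contra hle
    refine absurd h (not_lt.2 (Finset.card_le_card fun l hl => ?_))
    simp only [Finset.mem_filter, Finset.mem_univ, true_and] at hl ⊢
    exact hl.trans_le (not_lt.1 hle)
  · intro h
    refine Finset.card_lt_card ((Finset.ssubset_iff_of_subset fun l hl => ?_).2 ⟨k, ?_, ?_⟩)
    · simp only [Finset.mem_filter, Finset.mem_univ, true_and] at hl ⊢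
      exact hl.trans h
    · simpa using h
    · simp

theorem arc_under_lt (k : Fin G.crossings) : (G.arc (G.passage (k, false)) : ℕ) < G.crossings := by
  have h : (Finset.univ.filter fun l => G.passage (l, false) < G.passage (k, false)).card
      < (Finset.univ : Finset (Fin G.crossings)).card :=
    Finset.card_lt_card (Finset.filter_ssubset.2 ⟨k, Finset.mem_univ k, lt_irrefl _⟩)
  rw [arc_val]
  simpa using h

theorem associated_alexanderDet (hG : ∀ k, G.sign k = 1) :
    Associated G.alexanderDet (G.flowDet fun _ => .positive) := by
  let Q : Matrix (Fin (G.crossings + 1)) (Fin G.crossings) ℤ[T;T⁻¹] :=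
    Matrix.of fun a l => if G.arc (G.passage (l, false)) < a then 1 else 0
  have hQ0 : ∀ l, Q 0 l = 0 := fun l => by simp [Q]
  let π' : Fin G.crossings → Fin G.crossings := fun l => ⟨_, arc_under_lt l⟩
  have hπ : Function.Injective π' := fun k l h => by
    have h0 : (G.arc (G.passage (k, false)) : ℕ) = G.arc (G.passage (l, false)) :=
      Fin.mk.inj h
    have h1 := Fin.ext h0
    have h2 : ∀ a b : Fin G.crossings, G.arc (G.passage (a, false)) = G.arc (G.passage (b, false)) →
        G.passage (b, false) ≤ G.passage (a, false) := fun a b hab =>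
      not_lt.1 fun hlt => (arc_lt_arc_iff.2 hlt).ne hab
    simpa using le_antisymm (h2 _ _ h1.symm) (h2 _ _ h1)
  let π : Equiv.Perm (Fin G.crossings) :=
    Equiv.ofBijective π' (Finite.injective_iff_bijective.1 hπ)
  have hQ1 : IsUnit (Q.submatrix Fin.succ id).det := by
    have h : Q.submatrix Fin.succ id = (Matrix.of fun i j : Fin G.crossings =>
        if j ≤ i then (1 : ℤ[T;T⁻¹]) else 0).submatrix id π := by
      ext1 i j
      have hij : G.arc (G.passage (j, false)) < i.succ ↔ π j ≤ i := Nat.lt_succ_iff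
      simp only [Q, Matrix.submatrix_apply, id, Matrix.of_apply, hij]
    rw [h, Matrix.det_permute', det_ite_le, mul_one]
    exact ((Equiv.Perm.sign π).isUnit.map (Int.castRingHom _))
  have hmul : G.alexanderMatrix * Q = -G.passageMatrix := by
    ext1 k l
    have hy : Q (G.arc (G.passage (k, false)) + 1) l
        = if G.passage (l, false) ≤ G.passage (k, false) then 1 else 0 := by
      have h1 : ((G.arc (G.passage (k, false)) + 1 : Fin (G.crossings + 1)) : ℕ)
          = G.arc (G.passage (k, false)) + 1 := Fin.val_add_one_of_lt (arc_under_lt k)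
      have h2 : G.arc (G.passage (l, false)) < G.arc (G.passage (k, false)) + 1
          ↔ G.passage (l, false) ≤ G.passage (k, false) := by
        rw [Fin.lt_def, h1, Nat.lt_succ_iff, ← Fin.le_def, ← not_lt, arc_lt_arc_iff, not_lt]
      simp only [Q, Matrix.of_apply, h2]
    have h : (G.alexanderMatrix * Q) k l
        = dotProduct (G.alexanderMatrix k) (fun a => Q a l) := rfl
    rw [h, alexanderMatrix, if_pos (hG k), sub_dotProduct, add_dotProduct, single_dotProduct,
      single_dotProduct, single_dotProduct, hy, ite_le_eq_add]
    simp only [Q, Matrix.of_apply, arc_lt_arc_iff, EmbeddingLike.apply_eq_iff_eq, Prod.mk.injEq, and_true,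
      Matrix.neg_apply, passageMatrix]
    ring
  have hdet : G.alexanderDet * (Q.submatrix Fin.succ id).det
      = (-1) ^ G.crossings * G.flowDet fun _ => .positive := by
    rw [alexanderDet, ← Matrix.det_mul, submatrix_succ_mul _ hQ0, hmul, Matrix.det_neg,
      flowDet_positive_eq_det, Fintype.card_fin]
  have h1 : Associated G.alexanderDet (G.alexanderDet * (Q.submatrix Fin.succ id).det) :=
    associated_mul_unit_right _ _ hQ1
  have h2 : Associated ((-1) ^ G.crossings * G.flowDet fun _ => .positive)
      (G.flowDet fun _ => .positive) :=
    associated_unit_mul_left _ _ (isUnit_one.neg.pow _)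
  rw [hdet] at h1
  exact h1.trans h2

/-! ### Uniqueness and existence of the Conway polynomial -/

/-- Evaluation of an integral Laurent polynomial at a nonzero real number. -/
noncomputable def evalReal (s : ℝ) (hs : s ≠ 0) : ℤ[T;T⁻¹] →+* ℝ :=
  eval₂ (Int.castRingHom ℝ) (Units.mk0 s hs)

theorem evalReal_T {s : ℝ} (hs : s ≠ 0) (k : ℤ) : evalReal s hs (T k) = s ^ k := by
  rw [evalReal, eval₂_T, Units.val_zpow_eq_zpow_val, Units.val_mk0]

theorem evalReal_aeval {s y : ℝ} (hs : s ≠ 0) (hy : s - s⁻¹ = y) (p : Polynomial ℤ) :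
    evalReal s hs (Polynomial.aeval (T 1 - T (-1) : ℤ[T;T⁻¹]) p) = Polynomial.aeval y p := by
  have h : (evalReal s hs) (T 1 - T (-1)) = y := by
    rw [map_sub, evalReal_T, evalReal_T, zpow_one, zpow_neg_one, hy]
  rw [Polynomial.aeval_def, Polynomial.hom_eval₂, h, Polynomial.aeval_def]
  exact congrArg (fun f => Polynomial.eval₂ f y p) (RingHom.ext_int _ _)

theorem exists_sub_inv_eq (y : ℝ) : ∃ s : ℝ, 0 < s ∧ s - s⁻¹ = y := by
  have h1 : 0 ≤ y ^ 2 + 4 := by positivity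
  have h2 := Real.sq_sqrt h1
  have h3 : |y| < √(y ^ 2 + 4) := by
    rw [← Real.sqrt_sq_eq_abs]
    exact Real.sqrt_lt_sqrt (sq_nonneg _) (by linarith)
  have h4 := neg_abs_le y
  have hs : 0 < (y + √(y ^ 2 + 4)) / 2 := by linarith
  refine ⟨_, hs, ?_⟩
  have h5 : (y + √(y ^ 2 + 4)) / 2 * ((y + √(y ^ 2 + 4)) / 2 - y) = 1 := by linear_combination h2 / 4
  rw [← eq_inv_of_mul_eq_one_right h5]
  ring

theorem exists_aeval_ne_zero {p : Polynomial ℤ} (hp : p ≠ 0) :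
    ∃ y : ℝ, y ≠ 0 ∧ Polynomial.aeval y p ≠ 0 := by
  by_contra! h
  have h1 : (Polynomial.X * p).map (Int.castRingHom ℝ) = 0 := by
    refine Polynomial.funext fun y => ?_
    rw [Polynomial.eval_map, ← algebraMap_int_eq, ← Polynomial.aeval_def, map_mul,
      Polynomial.aeval_X, Polynomial.eval_zero]
    by_cases hy : y = 0
    · rw [hy, zero_mul]
    · rw [h y hy, mul_zero]
  rw [Polynomial.map_eq_zero_iff (RingHom.injective_int _)] at h1
  exact mul_ne_zero Polynomial.X_ne_zero hp h1

theorem aeval_injective :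
    Function.Injective (Polynomial.aeval (T 1 - T (-1) : ℤ[T;T⁻¹]) : Polynomial ℤ → ℤ[T;T⁻¹]) := by
  refine (injective_iff_map_eq_zero _).2 fun p hp => ?_
  by_contra h
  obtain ⟨y, -, hy⟩ := exists_aeval_ne_zero h
  obtain ⟨s, hs, hsy⟩ := exists_sub_inv_eq y
  rw [← evalReal_aeval hs.ne' hsy, hp, map_zero] at hy
  exact hy rfl

/-- The units of the ring of integral Laurent polynomials are `± T k`. -/
theorem exists_eq_of_isUnit {u : ℤ[T;T⁻¹]} (hu : IsUnit u) :
    ∃ k : ℤ, u = T k ∨ u = -T k := by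
  obtain ⟨v, huv⟩ := hu.exists_right_inv
  obtain ⟨a, f, hf⟩ := exists_T_pow u
  obtain ⟨b, g, hg⟩ := exists_T_pow v
  have hfg : f * g = Polynomial.X ^ (a + b) := by
    refine Polynomial.toLaurent_injective ?_
    rw [map_mul, hf, hg, Polynomial.toLaurent_X_pow, Nat.cast_add, T_add]
    linear_combination T (a : ℤ) * T (b : ℤ) * huv
  obtain ⟨j, -, hj⟩ := (dvd_prime_pow Polynomial.prime_X _).1 (Dvd.intro g hfg)
  obtain ⟨w, hw⟩ := hj.symm
  obtain ⟨r, hr, hrw⟩ := Polynomial.isUnit_iff.1 w.isUnit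
  have hu' : u = f.toLaurent * T (-a) := by
    rw [hf, mul_T_assoc, add_neg_cancel, T_zero, mul_one]
  refine ⟨j + -a, ?_⟩
  rw [hu', ← hw, ← hrw, map_mul, Polynomial.toLaurent_X_pow, Polynomial.toLaurent_C, T_add]
  rcases Int.isUnit_iff.1 hr with rfl | rfl
  · left; rw [map_one, mul_one]
  · right; rw [map_neg, map_one]; ring

theorem IsConwayPolynomial.unique {p q : Polynomial ℤ} (hp : G.IsConwayPolynomial p)
    (hq : G.IsConwayPolynomial q) : p = q := by
  obtain ⟨u, hu⟩ := hq.2.trans hp.2.symm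
  have hq0 : q ≠ 0 := fun h => by simpa [h] using hq.1
  obtain ⟨k, hk⟩ := exists_eq_of_isUnit u.isUnit
  -- The two solutions `s` and `-s⁻¹` of `s - s⁻¹ = y` give the same value of `p`.
  have hk0 : k = 0 := by
    obtain ⟨y, hy0, hy⟩ := exists_aeval_ne_zero hq0
    obtain ⟨s, hs, hsy⟩ := exists_sub_inv_eq y
    have hs' : -s⁻¹ ≠ 0 := neg_ne_zero.2 (inv_ne_zero hs.ne')
    have hsy' : -s⁻¹ - (-s⁻¹)⁻¹ = y := by rw [inv_neg, inv_inv, ← hsy]; ring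
    have h1 := congrArg (evalReal s hs.ne') hu
    have h2 := congrArg (evalReal _ hs') hu
    rw [map_mul, evalReal_aeval _ hsy, evalReal_aeval _ hsy] at h1
    rw [map_mul, evalReal_aeval _ hsy', evalReal_aeval _ hsy', ← h1] at h2
    have h3 := mul_left_cancel₀ hy h2
    have h4 : ((-s⁻¹) ^ k) ^ 2 = (s ^ k) ^ 2 := by
      rcases hk with hk | hk <;> rw [hk] at h3
      · rw [evalReal_T, evalReal_T] at h3
        rw [h3]
      · rw [map_neg, map_neg, evalReal_T, evalReal_T, neg_inj] at h3
        rw [h3]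
    have h5 : (s ^ k)⁻¹ ^ 2 = (s ^ k) ^ 2 := by
      rw [← h4, ← zpow_natCast, ← zpow_natCast, ← inv_zpow, ← zpow_mul, ← zpow_mul,
        Even.neg_zpow (by simp)]
    have hpos : 0 < s ^ k := zpow_pos hs k
    have h6 : (s ^ k)⁻¹ = s ^ k := (pow_left_inj₀ (inv_pos.2 hpos).le hpos.le two_ne_zero).1 h5
    have h7 : s ^ k = 1 := by
      have : s ^ k * s ^ k = 1 := by
        nth_rewrite 1 [← h6]
        exact inv_mul_cancel₀ hpos.ne'
      nlinarith
    have hs1 : s ≠ 1 := by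
      rintro rfl
      exact hy0 (by rw [← hsy]; norm_num)
    exact zpow_right_injective₀ hs hs1 (show s ^ k = s ^ (0 : ℤ) by rw [h7, zpow_zero])
  rw [hk0, T_zero] at hk
  rcases hk with hk | hk <;> rw [hk] at hu
  · rw [mul_one] at hu
    exact (aeval_injective hu).symm
  · rw [mul_neg, mul_one, ← map_neg] at hu
    have h1 := hp.1
    rw [← aeval_injective hu, Polynomial.coeff_neg, hq.1] at h1
    omega

open Classical in
variable (G) in
/-- The generating polynomial of the admissible sets by the number of their elements. -/
noncomputable def stateSum : Polynomial ℤ := ∑ S with G.Admissible S, Polynomial.X ^ S.card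

open Classical in
theorem stateSum_coeff (m : ℕ) :
    G.stateSum.coeff m = (Finset.univ.filter fun S => G.Admissible S ∧ S.card = m).card := by
  rw [stateSum, Polynomial.finsetSum_coeff]
  simp only [Polynomial.coeff_X_pow, Finset.sum_boole, Finset.filter_filter, Nat.cast_inj]
  congr 1
  ext S
  simp [eq_comm]

theorem isConwayPolynomial_stateSum (hG : ∀ k, G.sign k = 1) (hP : G.IsPlanar) :
    G.IsConwayPolynomial G.stateSum := by
  classical
  constructor
  · rw [stateSum_coeff]
    have : (Finset.univ.filter fun S => G.Admissible S ∧ S.card = 0) = {∅} := by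
      ext S
      simp only [Finset.mem_filter, Finset.mem_univ, true_and, Finset.card_eq_zero,
        Finset.mem_singleton]
      exact ⟨fun h => h.2, fun h => ⟨h ▸ admissible_empty, h⟩⟩
    rw [this, Finset.card_singleton, Nat.cast_one]
  · refine Associated.trans ?_ (associated_alexanderDet hG).symm
    set e₀ := (Finset.univ.filter fun k => G.UnderFirst ∅ k).card with he₀
    have h : G.flowDet (fun _ => .positive) = T 2 ^ e₀
        * Polynomial.aeval (T 1 - T (-1) : ℤ[T;T⁻¹]) G.stateSum := by
      rw [flowDet_positive hG hP, stateSum, map_sum, Finset.mul_sum]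
      refine Finset.sum_congr rfl fun S hS => ?_
      have hw := card_underFirst hG hP (Finset.mem_filter.1 hS).2.isSingle
      rw [← he₀] at hw
      set e := (Finset.univ.filter fun k => k ∉ S ∧ G.UnderFirst S k).card
      obtain ⟨d, hd⟩ : ∃ d, e₀ = e + d := ⟨e₀ - e, by omega⟩
      have hS2 : S.card = 2 * d := by omega
      have hz : (1 - T 2 : ℤ[T;T⁻¹]) ^ 2 = T 2 * (T 1 - T (-1)) ^ 2 := by
        have h2 : (T 2 : ℤ[T;T⁻¹]) = T 1 * T 1 := by rw [← T_add]; rfl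
        have h3 : (T 1 : ℤ[T;T⁻¹]) * T (-1) = 1 := by rw [← T_add]; simp
        rw [h2]
        linear_combination (2 * T 1 ^ 2 - T 1 * T (-1) - 1) * h3
      rw [hS2, hd, map_pow, Polynomial.aeval_X, pow_mul, hz, mul_pow, ← pow_mul, pow_add]
      ring
    rw [h]
    exact associated_unit_mul_right _ _ ((isUnit_T 2).pow e₀)

end GaussDiagram

open Classical in
/-- The coefficients of the Conway polynomial of a positive diagram count the admissible sets. -/
theorem KnotDiagram.conwayCoeff_eq_card {D : KnotDiagram} (hD : D.IsPositive) (m : ℕ) :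
    D.conwayCoeff m
      = (Finset.univ.filter fun S => D.toGaussDiagram.Admissible S ∧ S.card = m).card := by
  have h := GaussDiagram.isConwayPolynomial_stateSum hD D.planar
  have h' : D.toGaussDiagram.IsConwayPolynomial D.conwayPolynomial :=
    Classical.epsilon_spec (p := D.toGaussDiagram.IsConwayPolynomial) ⟨_, h⟩
  rw [KnotDiagram.conwayCoeff, h'.unique h, GaussDiagram.stateSum_coeff]

/-! ### Admissible pairs -/

namespace GaussDiagram

variable {G : GaussDiagram}

/-- The walk follows the knot until it meets the first smoothed crossing. -/
theorem walk_eq_of_le {S : Finset (Fin G.crossings)} {a : Fin (2 * G.crossings + 1)}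
    (h : ∀ k ∈ S, ∀ b, a ≤ (G.passage (k, b)).castSucc) {i : ℕ} (hi : i ≤ a) :
    (G.walk S i : ℕ) = i := by
  induction i with
  | zero => rfl
  | succ i ih =>
    have hw := ih (by omega)
    have hl : G.walk S i ≠ Fin.last _ := fun hl => by
      have := a.is_lt
      rw [hl, Fin.val_last] at hw
      omega
    obtain ⟨j, hj⟩ := Fin.exists_castSucc_eq.2 hl
    obtain ⟨k, b, rfl⟩ := exists_passage j
    have hk : k ∉ S := fun hk => by
      have := Fin.le_def.1 (h k hk b)
      rw [hj] at this
      omega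
    rw [walk_succ, ← hj, step_castSucc, turn_passage, if_neg hk, Fin.val_succ,
      ← Fin.val_castSucc, hj, hw]

theorem admissible_pair {p q : Fin G.crossings}
    (h1 : G.passage (p, false) < G.passage (q, true))
    (h2 : G.passage (q, true) < G.passage (p, true))
    (h3 : G.passage (p, true) < G.passage (q, false)) : G.Admissible {p, q} := by
  have hpq : p ≠ q := by
    rintro rfl
    exact lt_asymm h3 (h1.trans h2)
  rw [Fin.lt_def] at h1 h2 h3
  set up := (G.passage (p, false) : ℕ) with hup
  set op := (G.passage (p, true) : ℕ) with hop
  set uq := (G.passage (q, false) : ℕ) with huq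
  set oq := (G.passage (q, true) : ℕ) with hoq
  -- The walk runs through the five segments cut out by the four endpoints, the second, the third
  -- and the fourth one in the opposite order.
  let τ : Fin (2 * G.crossings + 1) → ℕ := fun e =>
    if (e : ℕ) ≤ up then e else if (e : ℕ) ≤ oq then e + uq - oq
    else if (e : ℕ) ≤ op then e + uq + up - oq - op
    else if (e : ℕ) ≤ uq then e + up - op else e
  have hτ0 : τ 0 = 0 := by simp [τ]
  have hτs : ∀ j, τ (G.turn {p, q} j).succ = τ j.castSucc + 1 := by
    intro j
    obtain ⟨k, b, rfl⟩ := exists_passage j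
    by_cases hk : k ∈ ({p, q} : Finset (Fin G.crossings))
    · rw [turn_passage, if_pos hk]
      rw [Finset.mem_insert, Finset.mem_singleton] at hk
      rcases hk with rfl | rfl <;> cases b <;>
        simp only [τ, Fin.val_succ, Fin.val_castSucc, Bool.not_true, Bool.not_false, ← hup, ← hop,
          ← huq, ← hoq] <;> split_ifs <;> omega
    · rw [turn_passage, if_neg hk]
      rw [Finset.mem_insert, Finset.mem_singleton, not_or] at hk
      have hne : ∀ l b', k ≠ l → (G.passage (k, b) : ℕ) ≠ G.passage (l, b') := by
        intro l b' hl h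
        exact hl (passage_inj.1 (Fin.ext h)).1
      have n1 := hne p false hk.1
      have n2 := hne p true hk.1
      have n3 := hne q false hk.2
      have n4 := hne q true hk.2
      simp only [τ, Fin.val_succ, Fin.val_castSucc]
      split_ifs <;> omega
  have hw := walk_of_time hτ0 hτs
  have hS : G.IsSingle {p, q} := fun e => ⟨_, hw e⟩
  have htime : ∀ j : Fin (2 * G.crossings), (hS.time j.castSucc : ℕ) = τ j.castSucc := fun j => by
    have := hS.time_walk (IsSingle.time_lt_of_walk_eq (hw j.castSucc)).le
    rwa [hw] at this
  refine ⟨hS, fun k hk => hS.underFirst_iff.2 ?_⟩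
  rw [htime, htime]
  rw [Finset.mem_insert, Finset.mem_singleton] at hk
  rcases hk with rfl | rfl <;>
    simp only [τ, Fin.val_castSucc, ← hup, ← hop, ← huq, ← hoq] <;> split_ifs <;> omega

/-- A nonempty admissible set contains an admissible pair: the crossing `p` of the first endpoint, and the
crossing `q` at which the walk first jumps into the interval between the two endpoints of `p`. This
jump is the first visit to `q`, so it starts from the under-passage of `q`. -/
theorem Admissible.exists_pair {S : Finset (Fin G.crossings)} (hS : G.Admissible S)
    (hne : S.Nonempty) :
    ∃ p ∈ S, ∃ q ∈ S, p ≠ q ∧ G.Admissible {p, q} := by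
  classical
  -- The first endpoint of `S` on the circle.
  obtain ⟨⟨p, b⟩, hpb, hmin⟩ := Finset.exists_min_image (S ×ˢ (Finset.univ : Finset Bool)) G.passage
    (hne.product Finset.univ_nonempty)
  have hp : p ∈ S := (Finset.mem_product.1 hpb).1
  have hmin' : ∀ k ∈ S, ∀ b', G.passage (p, b) ≤ G.passage (k, b') := fun k hk b' =>
    hmin (k, b') (Finset.mem_product.2 ⟨hk, Finset.mem_univ _⟩)
  have hstart : ∀ {i : ℕ}, i ≤ G.passage (p, b) → (G.walk S i : ℕ) = i := fun {i} hi =>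
    walk_eq_of_le (a := (G.passage (p, b)).castSucc)
      (fun k hk b' => Fin.castSucc_le_castSucc_iff.2 (hmin' k hk b')) hi
  have hb : b = false := by
    by_contra hb
    rw [Bool.not_eq_false] at hb
    subst hb
    obtain ⟨i, hi, hbefore⟩ := hS.underFirst p hp
    by_cases hle : i ≤ G.passage (p, true)
    · have h1 := hstart hle
      rw [hi, Fin.val_castSucc] at h1
      have h2 := hmin' p hp false
      rw [Fin.le_def] at h2
      have h3 : G.passage (p, true) = G.passage (p, false) := Fin.ext (by omega)
      simp at h3
    · exact hbefore _ (not_le.1 hle).le (Fin.ext (hstart le_rfl))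
  subst hb
  have hlt : G.passage (p, false) < G.passage (p, true) :=
    (hmin' p hp true).lt_of_ne (by simp)
  -- The first time at which the walk enters the interval between the endpoints of `p`.
  let I : ℕ → Prop := fun i => G.passage (p, false) < (G.walk S i : ℕ)
    ∧ (G.walk S i : ℕ) ≤ G.passage (p, true)
  have hI : ∃ i, I i := by
    obtain ⟨i, hi⟩ := hS.isSingle (G.passage (p, true)).castSucc
    exact ⟨i, by simp only [I, hi, Fin.val_castSucc]; exact ⟨hlt, le_rfl⟩⟩
  obtain ⟨i, hi, hbefore⟩ : ∃ i, I i ∧ ∀ j < i, ¬ I j :=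
    ⟨Nat.find hI, Nat.find_spec hI, fun j hj => Nat.find_min hI hj⟩
  cases i with
  | zero =>
    simp only [I, walk_zero, Fin.val_zero] at hi
    omega
  | succ i =>
    have hni := hbefore i (Nat.lt_succ_self i)
    have hl : G.walk S i ≠ Fin.last _ := fun hl => by
      have h1 := hi.2
      rw [walk_succ, hl, step_last, Fin.val_last] at h1
      omega
    obtain ⟨j, hj⟩ := Fin.exists_castSucc_eq.2 hl
    obtain ⟨q, b, rfl⟩ := exists_passage j
    have hin := hi
    simp only [I, walk_succ, ← hj, step_castSucc, turn_passage, Fin.val_succ] at hin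
    simp only [I, ← hj, Fin.val_castSucc] at hni
    have hpass : ∀ k b l b', (G.passage (k, b) : ℕ) = G.passage (l, b') → k = l ∧ b = b' :=
      fun k b l b' h => passage_inj.1 (Fin.ext h)
    have hq : q ∈ S := by
      by_contra hq
      rw [if_neg hq] at hin
      have := (hpass q b p false (by omega)).1
      exact hq (this ▸ hp)
    rw [if_pos hq] at hin
    have hqp : q ≠ p := by
      rintro rfl
      cases b
      · rw [Bool.not_false] at hin; omega
      · rw [Fin.lt_def] at hlt; omega
    have hm := Fin.le_def.1 (hmin' q hq b)
    have n1 : (G.passage (q, b) : ℕ) ≠ G.passage (p, false) := fun h => hqp (hpass _ _ _ _ h).1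
    have n2 : (G.passage (q, !b) : ℕ) ≠ G.passage (p, false) := fun h => hqp (hpass _ _ _ _ h).1
    -- The other endpoint of `q` lies in the interval, where the walk has not been before.
    have hother : ∀ l ≤ i, G.walk S l ≠ (G.passage (q, !b)).castSucc := by
      intro l hl hw
      refine hbefore l (Nat.lt_succ_of_le hl) ?_
      simp only [I, hw, Fin.val_castSucc]
      omega
    have hbf : b = false := by
      by_contra hbt
      rw [Bool.not_eq_false] at hbt
      subst hbt
      obtain ⟨l, hl, hlb⟩ := hS.underFirst q hq
      by_cases hli : l ≤ i
      · exact hother l hli hl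
      · exact hlb i (by omega) hj.symm
    subst hbf
    refine ⟨p, hp, q, hq, hqp.symm, admissible_pair ?_ ?_ ?_⟩ <;> rw [Fin.lt_def] <;>
      simp only [Bool.not_false] at hin n2 <;> omega

end GaussDiagram

theorem proposition3p2 (D : KnotDiagram) (hD : D.IsPositive) (n : ℕ) (hn : 1 ≤ n) :
    (D.conwayCoeff (2 * n) : ℝ) ≤
      1 / ((2 * n - 2).factorial : ℝ) * (D.crossings : ℝ) ^ (2 * n - 2) * (D.conwayCoeff 2 : ℝ) := by
  classical
  rw [KnotDiagram.conwayCoeff_eq_card hD, KnotDiagram.conwayCoeff_eq_card hD, Int.cast_natCast,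
    Int.cast_natCast]
  set A := Finset.univ.filter fun S => D.toGaussDiagram.Admissible S ∧ S.card = 2 * n
  set P := Finset.univ.filter fun S => D.toGaussDiagram.Admissible S ∧ S.card = 2
  have hex : ∀ S ∈ A, ∃ R ∈ P, R ⊆ S := by
    intro S hS
    obtain ⟨hadm, hcard⟩ := (Finset.mem_filter.1 hS).2
    obtain ⟨p, hp, q, hq, hpq, h⟩ := hadm.exists_pair (Finset.card_pos.1 (by omega))
    refine ⟨{p, q}, Finset.mem_filter.2 ⟨Finset.mem_univ _, h, Finset.card_pair hpq⟩, ?_⟩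
    rw [Finset.insert_subset_iff, Finset.singleton_subset_iff]
    exact ⟨hp, hq⟩
  choose! r hrP hrS using hex
  have hcard : A.card ≤ (P ×ˢ (Finset.univ : Finset (Fin D.crossings)).powersetCard
      (2 * n - 2)).card := by
    refine Finset.card_le_card_of_injOn (fun S => (r S, S \ r S)) (fun S hS => ?_) ?_
    · have h1 := (Finset.mem_filter.1 hS).2.2
      have h2 := (Finset.mem_filter.1 (hrP S hS)).2.2
      refine Finset.mem_product.2 ⟨hrP S hS, Finset.mem_powersetCard.2 ⟨Finset.subset_univ _, ?_⟩⟩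
      rw [Finset.card_sdiff_of_subset (hrS S hS), h1, h2]
    · intro S hS S' hS' h
      simp only [Prod.mk.injEq] at h
      rw [← Finset.union_sdiff_of_subset (hrS S hS), h.2, h.1,
        Finset.union_sdiff_of_subset (hrS S' hS')]
  rw [Finset.card_product, Finset.card_powersetCard, Finset.card_univ, Fintype.card_fin] at hcard
  calc (A.card : ℝ) ≤ P.card * (D.crossings.choose (2 * n - 2) : ℕ) := by exact_mod_cast hcard
    _ ≤ P.card * ((D.crossings : ℝ) ^ (2 * n - 2) / (2 * n - 2).factorial) := by
        gcongr
        exact Nat.choose_le_pow_div _ _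
    _ = _ := by ring
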